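/- **Theorem (Hamel–Goulden formulas with strict flags).** *Shapes.* Let $\lambda/\mu$ be a nonempty skew partition whose diagram is edgewise connected, and let $r\in\mathbb Z$. Give the cell $(i,j)$ of $\lambda/\mu$ the (shifted) content $c(i,j)=j-i+r-1+\lambda'_1$; the pair $(\lambda/\mu,r)$ is called an r-shape with root content $r$, and is again written $\lambda/\mu$. *Flags.* Let $n\ge\lambda_1$. Column flags for $\lambda/\mu$ are vectors $\mathbf a,\mathbf b\in\mathbb Z^n$ with $a_i-a_{i+1}\le\mu'_i-\mu'_{i+1}+1$ and $b_i-b_{i+1}\le\lambda'_i-\lambda'_{i+1}+1$ whenever $\mu'_i<\lambda'_{i+1}$; they are strict if moreover $a_i-a_{i+1}\le1$ whenever $\mu'_i<\lambda'_{i+1}$. Put $a'_i=a_i+c(\mu'_i+1,i)$ and $b'_i=b_i+c(\lambda'_i,i)$. *Functions.* For variables $\mathbf y=(y_i)_{i\in\mathbb Z}$, $\mathbf z=(z_i)_{i\in\mathbb Z}$ (arbitrary elements of a commutative ring) let $\mathbf y_{p,q}=(y_p,\dots,y_q)$, empty if $p>q$, let $e_m(\mathbf x/\mathbf w)=\sum_{i=0}^m(-1)^{m-i}e_i(\mathbf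 x)h_{m-i}(\mathbf w)$ for $m\ge0$ and $e_m(\mathbf x/\mathbf w)=0$ for $m<0$, and define $$\mathsf S^{\mathbf a,\mathbf b}_{\lambda/\mu}(\mathbf y/\mathbf z)=\det\left[e_{\lambda'_i-i-\mu'_j+j}(\mathbf y_{a_j,b_i}/\mathbf z_{a'_j,b'_i})\right]_{1\le i,j\le n}.$$ *Ribbons.* A ribbon is a nonempty connected skew diagram without a $2\times2$ block; its head is its bottom leftmost cell and its tail its top rightmost cell. Let $(\theta_1,\dots,\theta_k)$ be an outer ribbon decomposition of $\lambda/\mu$, i.e. a partition of its diagram into ribbons such that the head $\delta_i$ of each $\theta_i$ lies on the left or bottom perimeter and the tail $\gamma_i$ on the top or right perimeter of $\lambda/\mu$. A cell of $\theta_i$ goes up if the cell above it is in $\theta_i$, or if it is the tail of $\theta_i$ and lies on the top perimeter; it goes right if the cell to its right is in $\theta_i$, or if it is the tail of $\theta_i$ and lies on the right perimeter. All cells of a given non-maximal content go in the same one of these two directions. The cutting strip is the ribbon with the same set of contents as $\lambda/\mu$ whose cells go (from each cell to the cell with the next content) in these directions. For contents $p\le q$ let $\Theta(p,q)$ be its sub-ribbon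 of cells with content in $[p,q]$, viewed as an r-shape with root content $p$; $\Theta(q+1,q)=\varnothing$, and $\Theta(p,q)$ is undefined for $p>q+1$. Put $\theta_i\#\theta_j=\Theta(c(\delta_i),c(\gamma_j))$. *Induced flags.* Let $\tilde{\mathbf a},\tilde{\mathbf b}$ be strict flags for $\lambda/\mu$. Let $\rho^{ij}_1,\rho^{ij}_2,\dots$ be the columns of $\theta_i\#\theta_j$ from left to right, let $m^{ij}_r$ be the leftmost cell of $\lambda/\mu$ having the same content as the top cell of $\rho^{ij}_r$, and let $M^{ij}_r$ be the rightmost cell of $\lambda/\mu$ having the same content as the bottom cell of $\rho^{ij}_r$. Put $$\tilde a^{ij}_r=\tilde a_{\mathrm{col}(m^{ij}_r)},\qquad \tilde b^{ij}_r=\tilde b_{\mathrm{col}(M^{ij}_r)}-\lambda'_{\mathrm{col}(M^{ij}_r)}+\mathrm{row}(M^{ij}_r).$$ Then $\tilde{\mathbf a}^{ij},\tilde{\mathbf b}^{ij}$ are column flags for the r-shape $\theta_i\#\theta_j$ whenever it is defined, and $$\mathsf S^{\tilde{\mathbf a},\tilde{\mathbf b}}_{\lambda/\mu}(\mathbf y/\mathbf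 z)=\det\left[\mathsf S^{\tilde{\mathbf a}^{ij},\tilde{\mathbf b}^{ij}}_{\theta_i\#\theta_j}(\mathbf y/\mathbf z)\right]_{1\le i,j\le k},$$ where the entry is $1$ if $\theta_i\#\theta_j=\varnothing$ and $0$ if $\theta_i\#\theta_j$ is undefined, and otherwise is the determinant above, of size the number of columns of $\theta_i\#\theta_j$. -/

import Mathlib

/-! Cells are pairs `(i, j)` of natural numbers, row first, in English notation, and all rows and
columns are numbered from `0`. `YoungDiagram.colLen` gives the parts of the conjugate partition:
`λ.colLen j` is `λ'_{j+1}`. -/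

/-- The elementary symmetric polynomial `e_k` in the variables `x i`, `i ∈ s`. -/
def elemSymm {R : Type*} [CommRing R] (k : ℕ) (s : Finset ℤ) (x : ℤ → R) : R :=
  ∑ t ∈ s.powersetCard k, ∏ i ∈ t, x i

/-- The complete homogeneous symmetric polynomial `h_k` in the variables `x i`, `i ∈ s`. -/
def homSymm {R : Type*} [CommRing R] (k : ℕ) (s : Finset ℤ) (x : ℤ → R) : R :=
  ∑ m ∈ s.sym k, ((m : Multiset ℤ).map x).prod

/-- The elementary supersymmetric function `e_n(y_s / z_t)` in the variables `y i` (`i ∈ s`) and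
`z i` (`i ∈ t`), equal to `0` for `n < 0`. -/
def superElem {R : Type*} [CommRing R] (n : ℤ) (s : Finset ℤ) (y : ℤ → R) (t : Finset ℤ)
    (z : ℤ → R) : R :=
  if n < 0 then 0
  else ∑ i ∈ Finset.range (n.toNat + 1),
    (-1) ^ (n.toNat - i) * elemSymm i s y * homSymm (n.toNat - i) t z

/-- A finite set of cells is connected if it is nonempty and any two of its cells are joined by a
path of edge-adjacent cells of the set (the Hasse diagram of `ℕ × ℕ` is the square grid). -/
def CellsConnected (s : Finset (ℕ × ℕ)) : Prop :=
  ((SimpleGraph.hasse (ℕ × ℕ)).induce (s : Set (ℕ × ℕ))).Connected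

/-- A ribbon, as a set of cells: a connected skew diagram without a `2 × 2` block. The skew
diagrams are the finite order-convex sets of cells. -/
structure IsRibbon (s : Finset (ℕ × ℕ)) : Prop where
  connected : CellsConnected s
  skew : (s : Set (ℕ × ℕ)).OrdConnected
  no_block : ∀ i j : ℕ,
    ¬ ((i, j) ∈ s ∧ (i, j + 1) ∈ s ∧ (i + 1, j) ∈ s ∧ (i + 1, j + 1) ∈ s)

/-- `x` is the head of `s`: its bottom leftmost cell. -/
def IsHead (s : Finset (ℕ × ℕ)) (x : ℕ × ℕ) : Prop :=
  x ∈ s ∧ ∀ w ∈ s, w.1 ≤ x.1 ∧ x.2 ≤ w.2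

/-- `x` is the tail of `s`: its top rightmost cell. -/
def IsTail (s : Finset (ℕ × ℕ)) (x : ℕ × ℕ) : Prop :=
  x ∈ s ∧ ∀ w ∈ s, x.1 ≤ w.1 ∧ w.2 ≤ x.2

/-- An r-shape: a skew partition `outer/inner` with a root content. -/
structure RShape where
  outer : YoungDiagram
  inner : YoungDiagram
  inner_le : inner ≤ outer
  root : ℤ

namespace RShape

/-- The diagram of an r-shape. -/
def cells (S : RShape) : Finset (ℕ × ℕ) := S.outer.cells \ S.inner.cells

/-- The shifted content; the bottom cell of the first column of `outer` has content `root`. -/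
def content (S : RShape) (x : ℕ × ℕ) : ℤ :=
  (x.2 : ℤ) - (x.1 : ℤ) + S.root - 1 + (S.outer.colLen 0 : ℤ)

/-- The number of columns `λ_1`. -/
def width (S : RShape) : ℕ := S.outer.rowLen 0

/-- The top cell of column `j` (when that column is nonempty). -/
def topCell (S : RShape) (j : ℕ) : ℕ × ℕ := (S.inner.colLen j, j)

/-- The bottom cell of column `j` (when that column is nonempty). -/
def bottomCell (S : RShape) (j : ℕ) : ℕ × ℕ := (S.outer.colLen j - 1, j)

/-- Column flags. Flags are written as functions on `ℕ`, of which only the entries of index less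
than the length of the flag are ever used; the conditions below concern `j + 1 < λ_1` only. -/
def IsFlags (S : RShape) (a b : ℕ → ℤ) : Prop :=
  ∀ j : ℕ, S.inner.colLen j < S.outer.colLen (j + 1) →
    a j - a (j + 1) ≤ (S.inner.colLen j : ℤ) - (S.inner.colLen (j + 1) : ℤ) + 1 ∧
    b j - b (j + 1) ≤ (S.outer.colLen j : ℤ) - (S.outer.colLen (j + 1) : ℤ) + 1

/-- Strict flags: column flags whose lower flag satisfies `a_j - a_{j+1} ≤ 1` in addition. -/
def IsStrictFlags (S : RShape) (a b : ℕ → ℤ) : Prop :=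
  S.IsFlags a b ∧
    ∀ j : ℕ, S.inner.colLen j < S.outer.colLen (j + 1) → a j - a (j + 1) ≤ 1

/-- The conjugate lower flag: add the contents `c(i, j)` of the top cells of the columns. For an
empty column the same formula, namely `j - μ'_j` up to the content shift, is used. -/
def conjLower (S : RShape) (a : ℕ → ℤ) (j : ℕ) : ℤ :=
  a j + ((j : ℤ) - (S.inner.colLen j : ℤ) + S.root - 1 + (S.outer.colLen 0 : ℤ))

/-- The conjugate upper flag: add the contents of the bottom cells (row `λ'_j - 1`, numbered from
`0`) of the columns, with the same formula for an empty column. -/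
def conjUpper (S : RShape) (b : ℕ → ℤ) (j : ℕ) : ℤ :=
  b j + ((j : ℤ) - ((S.outer.colLen j : ℤ) - 1) + S.root - 1 + (S.outer.colLen 0 : ℤ))

/-- The flagged supersymmetric Schur function `S^{a,b}_{λ/μ}(y/z)`, as an `n × n` determinant. -/
noncomputable def flaggedSchur {R : Type*} [CommRing R] (S : RShape) (n : ℕ) (a b : ℕ → ℤ)
    (y z : ℤ → R) : R :=
  Matrix.det (Matrix.of fun i j : Fin n =>
    superElem ((S.outer.colLen i : ℤ) - (i : ℕ) - (S.inner.colLen j : ℤ) + (j : ℕ))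
      (Finset.Icc (a j) (b i)) y
      (Finset.Icc (S.conjLower a j) (S.conjUpper b i)) z)

/-- The cells of a given content. -/
def diagonal (S : RShape) (c : ℤ) : Finset (ℕ × ℕ) := S.cells.filter fun x => S.content x = c

/-- The leftmost cell of content `c`: the componentwise minimum over the diagonal, which is
a chain (junk `(0, 0)` if there is no such cell). -/
def leftmost (S : RShape) (c : ℤ) : ℕ × ℕ :=
  if h : (S.diagonal c).Nonempty then (S.diagonal c).inf' h id else (0, 0)

/-- The rightmost cell of content `c` (junk `(0, 0)` if there is no such cell). -/
def rightmost (S : RShape) (c : ℤ) : ℕ × ℕ :=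
  if h : (S.diagonal c).Nonempty then (S.diagonal c).sup' h id else (0, 0)

def OnLeftPerimeter (S : RShape) (x : ℕ × ℕ) : Prop :=
  x ∈ S.cells ∧ ¬ ∃ j, j + 1 = x.2 ∧ (x.1, j) ∈ S.cells

def OnRightPerimeter (S : RShape) (x : ℕ × ℕ) : Prop :=
  x ∈ S.cells ∧ (x.1, x.2 + 1) ∉ S.cells

def OnTopPerimeter (S : RShape) (x : ℕ × ℕ) : Prop :=
  x ∈ S.cells ∧ ¬ ∃ i, i + 1 = x.1 ∧ (i, x.2) ∈ S.cells

def OnBottomPerimeter (S : RShape) (x : ℕ × ℕ) : Prop :=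
  x ∈ S.cells ∧ (x.1 + 1, x.2) ∉ S.cells

/-- The r-shape with root content `r` whose diagram is the order-convex hull of `X`, so `X` itself
when `X` is order-convex: `outer` is the lower closure of `X`, and `inner` consists of the cells
of `outer` that lie weakly below and right of no cell of `X`. -/
def ofCells (X : Finset (ℕ × ℕ)) (r : ℤ) : RShape where
  outer :=
    { cells := X.biUnion fun s => Finset.Iic s
      isLowerSet := by
        intro p q hqp hp
        simp only [Finset.coe_biUnion, Finset.coe_Iic, Set.mem_iUnion, Set.mem_Iic,
          SetLike.mem_coe, exists_prop] at hp ⊢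
        obtain ⟨s, hs, hps⟩ := hp
        exact ⟨s, hs, hqp.trans hps⟩ }
  inner :=
    { cells := (X.biUnion fun s => Finset.Iic s).filter fun p => ∀ s ∈ X, ¬ s ≤ p
      isLowerSet := by
        intro p q hqp hp
        simp only [Finset.coe_filter, Finset.mem_biUnion, Finset.mem_Iic,
          Set.mem_ofPred_eq] at hp ⊢
        obtain ⟨⟨s, hs, hps⟩, h⟩ := hp
        exact ⟨⟨s, hs, hqp.trans hps⟩, fun t ht htq => h t ht (htq.trans hqp)⟩ }
  inner_le := YoungDiagram.cells_subset_iff.mp (Finset.filter_subset _ _)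
  root := r

end RShape

/-- An outer ribbon decomposition of an r-shape into `k` ribbons. The heads and tails are
determined by the ribbons. -/
structure OuterRibbonDecomposition (S : RShape) (k : ℕ) where
  ribbon : Fin k → Finset (ℕ × ℕ)
  head : Fin k → ℕ × ℕ
  tail : Fin k → ℕ × ℕ
  isRibbon : ∀ i, IsRibbon (ribbon i)
  isHead : ∀ i, IsHead (ribbon i) (head i)
  isTail : ∀ i, IsTail (ribbon i) (tail i)
  disjoint : ∀ i j, i ≠ j → Disjoint (ribbon i) (ribbon j)
  mem_cells_iff : ∀ x, x ∈ S.cells ↔ ∃ i, x ∈ ribbon i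
  head_perimeter : ∀ i, S.OnLeftPerimeter (head i) ∨ S.OnBottomPerimeter (head i)
  tail_perimeter : ∀ i, S.OnTopPerimeter (tail i) ∨ S.OnRightPerimeter (tail i)

namespace OuterRibbonDecomposition

variable {S : RShape} {k : ℕ}

/-- The cell `x` goes up: the cell above it lies in the same ribbon, or `x` is the tail of its
ribbon and lies on the top perimeter. (A cell other than the top right cell of a connected shape
goes right exactly when it does not go up. The direction of the top right cell, the one of
maximal content, has no influence on any of the ribbons `Θ(p, q)`.) -/
def GoesUp (D : OuterRibbonDecomposition S k) (x : ℕ × ℕ) : Prop :=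
  ∃ i, x ∈ D.ribbon i ∧
    ((∃ u, u + 1 = x.1 ∧ (u, x.2) ∈ D.ribbon i) ∨ (x = D.tail i ∧ S.OnTopPerimeter x))

/-- The cell of content `c` of the cutting strip goes up, i.e. the next cell of the strip, which
has content `c + 1`, is above it. All cells of `S` of content `c` have the same direction. -/
def StripGoesUp (D : OuterRibbonDecomposition S k) (c : ℤ) : Prop :=
  ∃ x ∈ S.cells, S.content x = c ∧ D.GoesUp x

open Classical in
/-- The cells of the sub-ribbon `Θ(p, q)` of the cutting strip, placed so that it touches
row `0` and column `0`. The cell of content `c ∈ [p, q]` has as row the number of upward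
steps from it to the tail, and as column the number of rightward steps from the head to it. -/
noncomputable def stripCells (D : OuterRibbonDecomposition S k) (p q : ℤ) : Finset (ℕ × ℕ) :=
  (Finset.Icc p q).image fun c =>
    (((Finset.Ico c q).filter fun d => D.StripGoesUp d).card,
      ((Finset.Ico p c).filter fun d => ¬ D.StripGoesUp d).card)

/-- The r-shape `θ_i # θ_j = Θ(c(δ_i), c(γ_j))`, where `δ_i` is the head of `θ_i` and `γ_j` the tail
of `θ_j`; it is the empty shape if `c(δ_i) = c(γ_j) + 1`. It is to be used only for
`c(δ_i) ≤ c(γ_j) + 1`, being undefined otherwise. -/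
noncomputable def hash (D : OuterRibbonDecomposition S k) (i j : Fin k) : RShape :=
  RShape.ofCells (D.stripCells (S.content (D.head i)) (S.content (D.tail j)))
    (S.content (D.head i))

/-- The induced lower flag on `θ_i # θ_j`, the canonical decomposition of which is the sequence of
its columns: `ã_{col(m)}` for `m` the leftmost cell of `S` with the content of the top cell of
the `r`-th column. -/
noncomputable def inducedLower (D : OuterRibbonDecomposition S k) (a : ℕ → ℤ) (i j : Fin k)
    (r : ℕ) : ℤ :=
  a (S.leftmost ((D.hash i j).content ((D.hash i j).topCell r))).2

/-- The induced upper flag on `θ_i # θ_j`: `b̃_{col(M)} - λ'_{col(M)} + row(M)` for `M` the rightmost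
cell of `S` with the content of the bottom cell of the `r`-th column (`row(M)` is counted
from `1` here). -/
noncomputable def inducedUpper (D : OuterRibbonDecomposition S k) (b : ℕ → ℤ) (i j : Fin k)
    (r : ℕ) : ℤ :=
  let M := S.rightmost ((D.hash i j).content ((D.hash i j).bottomCell r))
  b M.2 - (S.outer.colLen M.2 : ℤ) + ((M.1 : ℤ) + 1)

/-- The entry `S^{ã^{ij}, b̃^{ij}}_{θ_i # θ_j}(y/z)`: it is `0` when `θ_i # θ_j` is undefined, and `1`
(the determinant of the `0 × 0` matrix) when `θ_i # θ_j` is empty. -/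
noncomputable def ribbonEntry {R : Type*} [CommRing R] (D : OuterRibbonDecomposition S k)
    (a b : ℕ → ℤ) (y z : ℤ → R) (i j : Fin k) : R :=
  if S.content (D.tail j) + 1 < S.content (D.head i) then 0
  else (D.hash i j).flaggedSchur (D.hash i j).width (D.inducedLower a i j)
    (D.inducedUpper b i j) y z

end OuterRibbonDecomposition

/-! The induced flags depend on a cell only through its content. So every determinant in the theorem
is built from a single array U(p, q), the flagged function of one column with contents p, …, q - 1
(`columnEntry`), and the determinant identity rests only on U(p, p) = 1 and U(p, q) = 0 for q < p.

Cut the diagram into chains by letting each cell follow the cell below it or the cell to its left,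
and form a matrix indexed by all cells. The row of a cell with a predecessor is minus the unit
vector at that predecessor; the row of a head x has entries F(x, y). By `det_chainMatrix` its
determinant is that of the small matrix of F from heads to tails. With columns as chains and F(x, y)
= U(c(x), c(y) + 1), the small matrix is the defining matrix of the flagged Schur function without
its empty columns (`flaggedSchur_eq_det_cellMatrix`). With ribbons as chains, it has the size k of
the right-hand side.

The passage from columns to ribbons is made one diagonal at a time. When all cells of content c
change their predecessor from the cell below to the cell on the left, the determinant survives if U
is pivoted at (c, c), that is, if U(p, q) becomes U(p, c) U(c, q) - U(p, q) for p < c < q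
(`det_cellMatrix_cons`, whose linear algebra is `det_pivot`). Connectedness enters here: the cells
of content c - 1 interlace with those of content c. Ribbon decompositions are reached in this way
because directions are constant along diagonals (`goesUp_diagonal`).

Pivoting on an increasing list of contents produces Hessenberg determinants
(`pivots_eq_det_stripMatrix`). For the contents that the cutting strip enters by a step to the
right, these are the determinants that define the flagged functions of the sub-ribbons
(`flaggedSchur_strip`).

That the induced flags are flags is a separate matter: for adjacent columns of a ribbon the
condition says that a flag drops by at most the difference of the contents, which telescopes to
steps of content one in the original shape (`lowerAt_sub_le`, `upperAt_sub_le`). -/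

open Matrix

/-! ### Determinants: row exchange along a diagonal, chain matrices, block triangular reduction -/

section LinearAlgebra

variable {R : Type*} [CommRing R] {α : Type*} [Fintype α] [DecidableEq α]

/-- Adding to the rows of a matrix multiples of a fixed combination of rows. -/
theorem det_eq_of_row_combination (M M' : Matrix α α R) (X κ : α → R) (hκ : ∀ j, κ j * X j = 0)
    (h : ∀ i b, M' i b = M i b + X i * ∑ j, κ j * M j b) : M'.det = M.det := by
  -- The factor 1 + Xκᵀ has determinant 1 + κ·X = 1.
  have h1 : M' = (1 + replicateCol Unit X * replicateRow Unit κ) * M := by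
    ext i b
    rw [h, Matrix.add_mul, Matrix.one_mul, Matrix.add_apply, Matrix.mul_assoc]
    simp [Matrix.mul_apply]
  rw [h1, det_mul, det_one_add_replicateCol_mul_replicateRow]
  simp [dotProduct, hκ]

/-- Adding to the columns of a matrix multiples of a fixed combination of columns. -/
theorem det_eq_of_column_combination (M M' : Matrix α α R) (X κ : α → R)
    (hκ : ∀ j, κ j * X j = 0) (h : ∀ i b, M' i b = M i b + (∑ j, κ j * M i j) * X b) :
    M'.det = M.det := by
  rw [← det_transpose M', ← det_transpose M]
  refine det_eq_of_row_combination _ _ X κ hκ fun i b => ?_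
  rw [transpose_apply, h, mul_comm]
  rfl

theorem det_add_det_eq_zero_of_row (A C : Matrix α α R) (x : α)
    (h : ∀ i, i ≠ x → ∀ b, A i b = C i b)
    (h0 : (A.updateRow x fun b => A x b + C x b).det = 0) : A.det + C.det = 0 := by
  have h1 : (fun b => A x b + C x b) = A x + C x := rfl
  rw [h1, det_updateRow_add, updateRow_eq_self] at h0
  have h2 : A.updateRow x (C x) = C := by
    ext i b
    by_cases hi : i = x
    · subst hi; simp
    · rw [updateRow_ne hi, h i hi b]
  rwa [h2] at h0

/-- Rotating the rows `u 0, …, u N` and negating them negates the determinant. -/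
theorem det_rotate_neg {N : ℕ} (u : Fin (N + 1) ↪ α) (A B : Matrix α α R)
    (hB : ∀ p ∉ Set.range u, B p = A p)
    (h0 : ∀ b, B (u 0) b = -A (u (Fin.last N)) b)
    (hs : ∀ (k : Fin N) b, B (u k.succ) b = -A (u k.castSucc) b) : B.det = -A.det := by
  classical
  let τ : Equiv.Perm α :=
    Equiv.Perm.viaFintypeEmbedding (finRotate (N + 1)).symm u
  have hτ : ∀ k, τ (u k) = u ((finRotate (N + 1)).symm k) := fun k =>
    Equiv.Perm.viaFintypeEmbedding_apply_image _ _ _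
  let v : α → R := fun x => if x ∈ Set.range u then -1 else 1
  have hBv : B = Matrix.of fun i j => v i * (A.submatrix τ id) i j := by
    ext p b
    by_cases hp : p ∈ Set.range u
    · obtain ⟨k, rfl⟩ := hp
      have hv : v (u k) = -1 := by simp [v]
      rw [of_apply, hv, submatrix_apply, hτ]
      refine Fin.cases ?_ (fun k => ?_) k
      · have : (finRotate (N + 1)).symm 0 = Fin.last N := by
          rw [Equiv.symm_apply_eq]; simp
        rw [this, h0]; simp
      · have : (finRotate (N + 1)).symm k.succ = k.castSucc := by
          rw [Equiv.symm_apply_eq]; simp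
        rw [this, hs]; simp
    · have hv : v p = 1 := by simp only [v, if_neg hp]
      rw [of_apply, hv, submatrix_apply, hB p hp,
        Equiv.Perm.viaFintypeEmbedding_apply_notMem_range _ _ hp]
      simp
  have hprod : ∏ i, v i = (-1) ^ (N + 1) := by
    have h1 : ∏ i, v i = ∏ i ∈ Finset.univ.map u, (-1 : R) := by
      rw [← Finset.prod_subset (Finset.subset_univ (Finset.univ.map u))]
      · refine Finset.prod_congr rfl fun i hi => ?_
        have : i ∈ Set.range u := by simpa using hi
        simp only [v, if_pos this]
      · intro i _ hi
        have : i ∉ Set.range u := by simpa using hi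
        simp only [v, if_neg this]
    rw [h1, Finset.prod_const, Finset.card_map, Finset.card_univ, Fintype.card_fin]
  rw [hBv, det_mul_column, det_permute, hprod, Equiv.Perm.viaFintypeEmbedding_sign,
    Equiv.Perm.sign_symm, sign_finRotate]
  -- The N + 1 negations contribute the first factor and the sign of an (N + 1)-cycle the second;
  -- the product is -1 for every N.
  have : ((-1 : R) ^ (N + 1)) * (-1) ^ N = -1 := by
    rw [← pow_add, show N + 1 + N = 2 * N + 1 by ring, pow_succ, pow_mul]; simp
  simp only [Nat.add_sub_cancel, Units.val_pow_eq_pow_val, Units.val_neg, Units.val_one,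
    Int.cast_pow, Int.cast_neg, Int.cast_one]
  rw [← mul_assoc, this, neg_one_mul]

/-- Off the rows `u`, the matrices `B` and `C` differ by the rank one term X wᵀ, and on the rows `u
k.succ` they agree. Operations that leave determinants unchanged make them agree everywhere except
in row `u 0`; by linearity in that row the sum is one determinant, which turns out to be singular.
Which operations serve depends on whether `l` and `m` are present. -/
theorem det_pivot_aux {N : ℕ} (u : Fin (N + 1) ↪ α) (y : Fin N → α) (l m : Option α)
    (B C : Matrix α α R) (w e X : α → R)
    (he : ∀ b, e b = (∑ k, if y k = b then 1 else 0) + (if l = some b then 1 else 0) +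
      (if m = some b then 1 else 0))
    (hlm : ∀ b, l = some b → m ≠ some b) (hly : ∀ k, l ≠ some (y k)) (hmy : ∀ k, m ≠ some (y k))
    (hX : ∀ p ∉ Set.range u, ∀ b, (l = some b ∨ m = some b) → B p b = X p)
    (hXu : ∀ k, X (u k) = 0)
    (hw : ∀ b, (l = some b ∨ m = some b) → w b = 0)
    (hp : ∀ p ∉ Set.range u, ∀ b, C p b = B p b - X p * w b)
    (hmidB : ∀ k b, B (u k.succ) b = if y k = b then 1 else 0)
    (hmidC : ∀ k b, C (u k.succ) b = if y k = b then 1 else 0)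
    (hB0 : ∀ b, B (u 0) b = if m.isSome then (if m = some b then 1 else 0) else -(w b + e b))
    (hC0 : ∀ b, C (u 0) b = if l.isSome then (if l = some b then 1 else 0) else w b - e b) :
    B.det + C.det = 0 := by
  classical
  -- `κ` sums all the rows `u`, while `δ` below selects row `u 0`. Both are orthogonal to `X`, which
  -- vanishes on these rows.
  let κ : α → R := fun j => if j ∈ Set.range u then 1 else 0
  have hκX : ∀ j, κ j * X j = 0 := by
    intro j
    by_cases hj : j ∈ Set.range u
    · obtain ⟨k, rfl⟩ := hj; simp [hXu]
    · simp only [κ, if_neg hj, zero_mul]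
  have hκ : ∀ f : α → R, ∑ j, κ j * f j = f (u 0) + ∑ k : Fin N, f (u k.succ) := by
    intro f
    rw [← Fin.sum_univ_succ (fun k => f (u k))]
    have h1 : ∑ j, κ j * f j = ∑ j ∈ Finset.univ.map u, f j := by
      rw [← Finset.sum_subset (Finset.subset_univ (Finset.univ.map u))]
      · refine Finset.sum_congr rfl fun i hi => ?_
        have : i ∈ Set.range u := by simpa using hi
        simp only [κ, if_pos this, one_mul]
      · intro i _ hi
        have : i ∉ Set.range u := by simpa using hi
        simp only [κ, if_neg this, zero_mul]
    rw [h1, Finset.sum_map]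
  let δ : α → R := fun j => if j = u 0 then 1 else 0
  have hδX : ∀ j, δ j * X j = 0 := by
    intro j
    by_cases hj : j = u 0
    · subst hj; simp [hXu]
    · simp only [δ, if_neg hj, zero_mul]
  have hδ : ∀ f : α → R, ∑ j, δ j * f j = f (u 0) := by
    intro f; simp [δ]
  have hrow : ∀ i, i ≠ u 0 → i ∉ Set.range u ∨ ∃ k : Fin N, i = u k.succ := by
    intro i hi
    by_cases h : i ∈ Set.range u
    · obtain ⟨k, rfl⟩ := h
      right
      obtain ⟨k', rfl⟩ := Fin.exists_succ_eq.mpr fun h : k = 0 => hi (by rw [h])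
      exact ⟨k', rfl⟩
    · exact Or.inl h
  rcases l with _ | l <;> rcases m with _ | m
  · -- neither
    -- Here e is the sum of the unit vectors at the `y k`, so the rows `u` of `B` add up to -w. The
    -- merged row `u 0` is -2e, which twice the sum of the middle rows cancels.
    have hB1 : (Matrix.of fun i b => B i b + X i * ∑ j, κ j * B j b).det = B.det :=
      det_eq_of_row_combination _ _ X κ hκX fun i b => rfl
    rw [← hB1]
    refine det_add_det_eq_zero_of_row _ _ (u 0) ?_ ?_
    · intro i hi b
      rw [of_apply, hκ (fun j => B j b), hB0, Finset.sum_congr rfl fun k _ => hmidB k b]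
      simp only [Option.isSome_none, Bool.false_eq_true, if_false, he]
      rcases hrow i hi with h | ⟨k, rfl⟩
      · rw [hp i h]; simp; ring
      · rw [hXu, hmidB, hmidC]; simp
    · let κ' : α → R := fun j => if j = u 0 then 0 else 2 * κ j
      set M := ((Matrix.of fun i b => B i b + X i * ∑ j, κ j * B j b).updateRow (u 0) fun b =>
        (Matrix.of fun i b => B i b + X i * ∑ j, κ j * B j b) (u 0) b + C (u 0) b) with hM
      have hM0 : ∀ b, M (u 0) b = -2 * ∑ k, if y k = b then 1 else 0 := by
        intro b
        rw [hM, updateRow_self, of_apply, hXu, hB0, hC0]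
        simp only [Option.isSome_none, Bool.false_eq_true, if_false, he]
        simp; ring
      have hMs : ∀ (k : Fin N) b, M (u k.succ) b = if y k = b then 1 else 0 := by
        intro k b
        rw [hM, updateRow_ne (by simp), of_apply, hXu, hmidB]; simp
      have h2 := det_eq_of_row_combination M
        (Matrix.of fun i b => M i b + δ i * ∑ j, κ' j * M j b) δ κ'
        (fun j => by by_cases hj : j = u 0 <;> simp [δ, κ', hj]) (fun i b => rfl)
      rw [← h2]
      refine det_eq_zero_of_row_eq_zero (u 0) fun b => ?_
      have h3 : ∑ j, κ' j * M j b = 2 * ∑ k, if y k = b then 1 else 0 := by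
        have h4 : ∀ j, κ' j * M j b = κ j * (if j = u 0 then 0 else 2 * M j b) := by
          intro j
          by_cases hj : j = u 0
          · simp [κ', hj]
          · simp only [κ', if_neg hj]; ring
        rw [Finset.sum_congr rfl fun j _ => h4 j, hκ fun j => if j = u 0 then 0 else 2 * M j b,
          if_pos rfl, zero_add, Finset.mul_sum]
        refine Finset.sum_congr rfl fun k _ => ?_
        rw [if_neg (by simp), hMs]
      rw [of_apply, hM0, h3]
      simp [δ]
  · -- `m` only
    -- The rows `u` of `B` now add up to e, and row `u 0` of `C` is w - e; off `u` both matrices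
    -- become B - X eᵀ. Column `m` of the merged matrix vanishes.
    have hB1 : (Matrix.of fun i b => B i b + (-X i) * ∑ j, κ j * B j b).det = B.det :=
      det_eq_of_row_combination _ _ (-X) κ (fun j => by simp [hκX]) fun i b => rfl
    have hC1 : (Matrix.of fun i b => C i b + X i * ∑ j, δ j * C j b).det = C.det :=
      det_eq_of_row_combination _ _ X δ hδX fun i b => rfl
    rw [← hB1, ← hC1]
    refine det_add_det_eq_zero_of_row _ _ (u 0) ?_ ?_
    · intro i hi b
      rw [of_apply, of_apply, hκ (fun j => B j b), hδ (fun j => C j b), hB0, hC0,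
        Finset.sum_congr rfl fun k _ => hmidB k b]
      simp only [Option.isSome_none, Option.isSome_some, Bool.false_eq_true, if_false, if_true, he]
      rcases hrow i hi with h | ⟨k, rfl⟩
      · rw [hp i h]; simp; ring
      · rw [hXu, hmidB, hmidC]; simp
    · refine det_eq_zero_of_column_eq_zero m fun i => ?_
      have hmid0 : ∑ k, (if y k = m then (1 : R) else 0) = 0 :=
        Finset.sum_eq_zero fun k _ => if_neg fun h => hmy k (by rw [h])
      by_cases hi : i = u 0
      · subst hi
        rw [updateRow_self, of_apply, of_apply, hXu, hB0, hC0]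
        simp [he, hw m (Or.inr rfl), hmid0]
      · rw [updateRow_ne hi, of_apply, hκ (fun j => B j m), hB0,
          Finset.sum_congr rfl fun k _ => hmidB k m]
        rcases hrow i hi with h | ⟨k, rfl⟩
        · rw [hX i h m (Or.inr rfl), hmid0]; simp
        · rw [hXu, hmidB, if_neg fun h => hmy k (by rw [h])]; simp
  · -- `l` only
    -- The mirror image of the preceding case: off `u` both matrices become B - X (w + e)ᵀ, and
    -- column `l` of the merged matrix vanishes.
    have hB1 : (Matrix.of fun i b => B i b + X i * ∑ j, δ j * B j b).det = B.det :=
      det_eq_of_row_combination _ _ X δ hδX fun i b => rfl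
    have hC1 : (Matrix.of fun i b => C i b + (-X i) * ∑ j, κ j * C j b).det = C.det :=
      det_eq_of_row_combination _ _ (-X) κ (fun j => by simp [hκX]) fun i b => rfl
    rw [← hB1, ← hC1]
    refine det_add_det_eq_zero_of_row _ _ (u 0) ?_ ?_
    · intro i hi b
      rw [of_apply, of_apply, hκ (fun j => C j b), hδ (fun j => B j b), hB0, hC0,
        Finset.sum_congr rfl fun k _ => hmidC k b]
      simp only [Option.isSome_none, Option.isSome_some, Bool.false_eq_true, if_false, if_true, he]
      rcases hrow i hi with h | ⟨k, rfl⟩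
      · rw [hp i h]; simp; ring
      · rw [hXu, hmidB, hmidC]; simp
    · refine det_eq_zero_of_column_eq_zero l fun i => ?_
      have hmid0 : ∑ k, (if y k = l then (1 : R) else 0) = 0 :=
        Finset.sum_eq_zero fun k _ => if_neg fun h => hly k (by rw [h])
      by_cases hi : i = u 0
      · subst hi
        rw [updateRow_self, of_apply, of_apply, hXu, hB0, hC0]
        simp [he, hw l (Or.inl rfl), hmid0]
      · rw [updateRow_ne hi, of_apply, hδ (fun j => B j l), hB0]
        rcases hrow i hi with h | ⟨k, rfl⟩
        · rw [hX i h l (Or.inl rfl), he, hmid0]; simp [hw l (Or.inl rfl)]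
        · rw [hXu, hmidB, if_neg fun h => hly k (by rw [h])]; simp
  · -- both
    have hml : m ≠ l := fun h => hlm l rfl (by rw [h])
    -- A column operation is used instead: column `m` of `C` equals `X` off `u`, so adding its
    -- multiples by w restores `B` there. Columns `l` and `m` of the merged matrix then coincide.
    have hC1 : (Matrix.of fun i b => C i b + (∑ j, (if j = m then 1 else 0) * C i j) * w b).det
        = C.det := by
      refine det_eq_of_column_combination _ _ w (fun j => if j = m then 1 else 0) ?_
        fun i b => rfl
      intro j
      by_cases hj : j = m
      · subst hj; simp [hw j (Or.inr rfl)]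
      · simp [hj]
    rw [← hC1]
    refine det_add_det_eq_zero_of_row _ _ (u 0) ?_ ?_
    · intro i hi b
      rw [of_apply]
      have h1 : ∑ j, (if j = m then 1 else 0) * C i j = C i m := by simp
      rw [h1]
      rcases hrow i hi with h | ⟨k, rfl⟩
      · rw [hp i h, hp i h, hw m (Or.inr rfl), hX i h m (Or.inr rfl)]; ring
      · rw [hmidB, hmidC, hmidC, if_neg (c := y k = m) fun h => hmy k (by rw [h])]; simp
    · refine det_zero_of_column_eq hml fun i => ?_
      by_cases hi : i = u 0
      · subst hi
        rw [updateRow_self, of_apply, of_apply, hB0, hC0, hB0, hC0]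
        simp [hw l (Or.inl rfl), hw m (Or.inr rfl), hml, hml.symm]
      · rw [updateRow_ne hi]
        rcases hrow i hi with h | ⟨k, rfl⟩
        · rw [hX i h m (Or.inr rfl), hX i h l (Or.inl rfl)]
        · rw [hmidB, hmidB, if_neg fun h => hmy k (by rw [h]), if_neg fun h => hly k (by rw [h])]

/-- The linear algebra of changing the predecessors on one diagonal `u` from below (`Z`) to left
(`C`, up to signs of rows and columns). The cell `y k` is below `u k` and to the left of `u (k +
1)`; `l` is the cell left of the first cell and `m` the cell below the last, if present. Rotating
and negating the rows `u` of `Z` aligns the middle rows with those of `C` and reduces the claim to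
`det_pivot_aux`. -/
theorem det_pivot {N : ℕ} (u : Fin (N + 1) ↪ α) (y : Fin N → α) (l m : Option α)
    (Z C : Matrix α α R) (w e X : α → R)
    (he : ∀ b, e b = (∑ k, if y k = b then 1 else 0) + (if l = some b then 1 else 0) +
      (if m = some b then 1 else 0))
    (hlm : ∀ b, l = some b → m ≠ some b) (hly : ∀ k, l ≠ some (y k)) (hmy : ∀ k, m ≠ some (y k))
    (hX : ∀ p ∉ Set.range u, ∀ b, (l = some b ∨ m = some b) → Z p b = X p)
    (hXu : ∀ k, X (u k) = 0)
    (hw : ∀ b, (l = some b ∨ m = some b) → w b = 0)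
    (hp : ∀ p ∉ Set.range u, ∀ b, C p b = Z p b - X p * w b)
    (hmidZ : ∀ k b, Z (u k.castSucc) b = -if y k = b then 1 else 0)
    (hmidC : ∀ k b, C (u k.succ) b = if y k = b then 1 else 0)
    (hZ0 : ∀ b, Z (u (Fin.last N)) b =
      if m.isSome then -(if m = some b then 1 else 0) else w b + e b)
    (hC0 : ∀ b, C (u 0) b = if l.isSome then (if l = some b then 1 else 0) else w b - e b) :
    C.det = Z.det := by
  classical
  let B : Matrix α α R := fun p => if p ∈ Set.range u then
    (if p = u 0 then -Z (u (Fin.last N)) else C p) else Z p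
  have hBout : ∀ p ∉ Set.range u, B p = Z p := fun p hp => by simp only [B, if_neg hp]
  have hB0 : B (u 0) = -Z (u (Fin.last N)) := by simp [B]
  have hBs : ∀ k : Fin N, B (u k.succ) = C (u k.succ) := fun k => by simp [B]
  have h1 : B.det = -Z.det := det_rotate_neg u Z B hBout (fun b => by rw [hB0]; rfl)
    (fun k b => by rw [hBs, hmidC, hmidZ, neg_neg])
  have h2 := det_pivot_aux u y l m B C w e X he hlm hly hmy
    (fun p hp b hb => by rw [hBout p hp, hX p hp b hb]) hXu hw
    (fun p hp' b => by rw [hBout p hp', hp p hp' b])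
    (fun k b => by rw [hBs, hmidC]) hmidC
    (fun b => by rw [hB0, Pi.neg_apply, hZ0]; split_ifs <;> simp) hC0
  rw [h1] at h2
  linear_combination h2

/-- A unitriangular matrix with respect to a rank function has determinant one. -/
theorem det_one_sub_of_rank (ρ : α → ℤ) (L : Matrix α α R) (h : ∀ x y, ρ x ≤ ρ y → L x y = 0) :
    (1 - L).det = 1 := by
  have ht : (1 - L).BlockTriangular fun x => -ρ x := by
    intro i j hij
    have hij' : ρ i < ρ j := by simpa using hij
    rw [Matrix.sub_apply, h i j hij'.le, one_apply_ne (fun e => by rw [e] at hij'; exact lt_irrefl _ hij'),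
      sub_zero]
  rw [ht.det]
  refine Finset.prod_eq_one fun a _ => ?_
  have : (1 - L).toSquareBlock (fun x => -ρ x) a = 1 := by
    ext ⟨i, hi⟩ ⟨j, hj⟩
    rw [toSquareBlock_def, of_apply, Matrix.sub_apply, h i j (by linarith), sub_zero]
    simp [one_apply, Subtype.ext_iff]
  rw [this, det_one]

open Classical in
/-- The matrix of a predecessor relation `pr`, with rows of `F` for the elements without
predecessor. -/
noncomputable def chainMatrix (pr : α → α → Prop) (F : α → α → R) : Matrix α α R :=
  fun x y => if ∃ w, pr w x then (if pr y x then -1 else 0) else F x y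

/-- If `pr` is the predecessor relation of a decomposition into chains, then the determinant of
the chain matrix is the determinant of the entries of `F` from the heads to the tails. -/
theorem det_chainMatrix {ι : Type*} [Fintype ι] [DecidableEq ι] (pr : α → α → Prop)
    (F : α → α → R) (ρ : α → ℤ) (rib : α → ι) (head tail : ι → α)
    (hρ : ∀ x y, pr y x → ρ y < ρ x)
    (hleft : ∀ x y y', pr y x → pr y' x → y = y')
    (hright : ∀ x x' y, pr y x → pr y x' → x = x')
    (hrib : ∀ x y, pr y x → rib y = rib x)
    (hhead : ∀ x, (¬ ∃ y, pr y x) ↔ x = head (rib x)) (hribhead : ∀ i, rib (head i) = i)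
    (htail : ∀ y, (¬ ∃ x, pr y x) ↔ y = tail (rib y)) (hribtail : ∀ i, rib (tail i) = i) :
    (chainMatrix pr F).det = Matrix.det (Matrix.of fun i j => F (head i) (tail j)) := by
  classical
  let L : Matrix α α R := fun x y => if pr y x then 1 else 0
  let J : Matrix α ι R := fun x i => if x = head i then 1 else 0
  let K : Matrix α ι R := fun y i => if y = tail i then 1 else 0
  let E : Matrix ι α R := fun i y => if rib y = i then 1 else 0
  let X : Matrix ι α R := fun i y => F (head i) y
  have hLa : ∀ x y, L x y = if pr y x then 1 else 0 := fun _ _ => rfl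
  have hJa : ∀ x i, J x i = if x = head i then 1 else 0 := fun _ _ => rfl
  have hKa : ∀ x i, K x i = if x = tail i then 1 else 0 := fun _ _ => rfl
  have hheadinj : ∀ x i, x = head i ↔ (¬ ∃ y, pr y x) ∧ rib x = i := by
    intro x i
    constructor
    · rintro rfl
      rw [hhead, hribhead]; exact ⟨rfl, rfl⟩
    · rintro ⟨h1, rfl⟩
      exact (hhead x).mp h1
  have htailinj : ∀ x i, x = tail i ↔ (¬ ∃ y, pr x y) ∧ rib x = i := by
    intro x i
    constructor
    · rintro rfl
      rw [htail, hribtail]; exact ⟨rfl, rfl⟩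
    · rintro ⟨h1, rfl⟩
      exact (htail x).mp h1
  have hJ : ∀ (G : Matrix ι α R) x y, (J * G) x y = if ∃ w, pr w x then 0 else G (rib x) y := by
    intro G x y
    simp only [mul_apply, hJa, hheadinj]
    by_cases h : ∃ w, pr w x <;> simp [h]
  have hK : ∀ (G : Matrix α α R) x i, (G * K) x i = G x (tail i) := by
    intro G x i
    simp [mul_apply, hKa]
  have hK' : ∀ (G : Matrix ι α R) x i, (G * K) x i = G x (tail i) := by
    intro G x i
    simp [mul_apply, hKa]
  have hZ : chainMatrix pr F = -L + J * X := by
    ext x y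
    rw [Matrix.add_apply, hJ]
    by_cases h : ∃ w, pr w x
    · simp only [chainMatrix, if_pos h, Matrix.neg_apply, hLa]
      split_ifs <;> simp
    · have hL : L x y = 0 := if_neg fun h' => h ⟨y, h'⟩
      simp only [chainMatrix, if_neg h, Matrix.neg_apply, hL, X]
      rw [← (hhead x).mp h]; simp
  -- `C` is the chain matrix in the special case where F is the indicator of lying in the same
  -- chain. Subtracting from each column that of its predecessor turns it into 1 - L, so det C = 1.
  set C : Matrix α α R := -L + J * E with hCdef
  have hLt : ∀ (G : Matrix α α R) x y, (G * Lᵀ) x y = ∑ w, if pr w y then G x w else 0 := by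
    intro G x y
    simp [mul_apply, hLa]
  have hLtz : ∀ (G : Matrix α α R) x y, (¬ ∃ w, pr w y) → (G * Lᵀ) x y = 0 := by
    intro G x y h
    rw [hLt]
    exact Finset.sum_eq_zero fun w _ => if_neg fun h' => h ⟨w, h'⟩
  have hLts : ∀ (G : Matrix α α R) x y w, pr w y → (G * Lᵀ) x y = G x w := by
    intro G x y w h
    rw [hLt, Finset.sum_eq_single w, if_pos h]
    · intro w' _ hw'
      exact if_neg fun h' => hw' (hleft _ _ _ h' h)
    · simp
  have hdetL : (1 - L).det = 1 := by
    refine det_one_sub_of_rank ρ L fun x y hxy => if_neg fun h => ?_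
    exact absurd (hρ _ _ h) (not_lt.mpr hxy)
  have hdetLt : (1 - Lᵀ).det = 1 := by
    rw [← hdetL, ← det_transpose (1 - L), transpose_sub, transpose_one]
  have hCE : ∀ x y, C x y = if ∃ w, pr w x then (if pr y x then -1 else 0) else
      (if rib y = rib x then 1 else 0) := by
    intro x y
    rw [hCdef, Matrix.add_apply, hJ]
    by_cases h : ∃ w, pr w x
    · simp only [if_pos h, Matrix.neg_apply, hLa]
      split_ifs <;> simp
    · have hL : L x y = 0 := if_neg fun h' => h ⟨y, h'⟩
      simp only [if_neg h, Matrix.neg_apply, hL, E]; simp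
  have hCL : C * (1 - Lᵀ) = 1 - L := by
    ext x y
    rw [Matrix.mul_sub, Matrix.mul_one, Matrix.sub_apply, Matrix.sub_apply]
    by_cases hy : ∃ w, pr w y
    · obtain ⟨w, hw⟩ := hy
      rw [hLts C x y w hw, hCE, hCE]
      by_cases hx : ∃ w, pr w x
      · have h1 : pr w x ↔ x = y :=
          ⟨fun h => hright _ _ _ h hw, fun h => by rw [h]; exact hw⟩
        simp only [if_pos hx, hLa, h1, one_apply]
        split_ifs <;> simp
      · have hxy : x ≠ y := fun h => hx ⟨w, by rw [h]; exact hw⟩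
        have hL : L x y = 0 := if_neg fun h' => hx ⟨y, h'⟩
        simp only [if_neg hx, hL, one_apply_ne hxy, hrib _ _ hw]
        simp
    · rw [hLtz C x y hy, hCE]
      by_cases hx : ∃ w, pr w x
      · have hxy : x ≠ y := fun h => hy (by rw [← h]; exact hx)
        simp only [if_pos hx, hLa, one_apply_ne hxy]
        split_ifs <;> simp
      · have hL : L x y = 0 := if_neg fun h' => hx ⟨y, h'⟩
        have h1 : rib y = rib x ↔ x = y := by
          constructor
          · intro h; rw [(hhead x).mp hx, (hhead y).mp hy, h]
          · rintro rfl; rfl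
        simp only [if_neg hx, hL, h1, one_apply]
  have hdetC : C.det = 1 := by
    have := congrArg det hCL
    rwa [det_mul, hdetL, hdetLt, mul_one] at this
  have hCK : C * K = J := by
    ext x i
    rw [hK, hCE]
    simp only [hJa, hheadinj, hribtail]
    by_cases h : ∃ w, pr w x
    · have h1 : ¬ pr (tail i) x := fun h' => ((htailinj (tail i) i).mp rfl).1 ⟨x, h'⟩
      simp [h, h1]
    · simp only [h, if_false, not_false_eq_true, true_and, eq_comm]
  -- Since C K = J, changing F only multiplies `C` by a low rank perturbation of the identity. The
  -- identity det(1 + AB) = det(1 + BA) then brings the determinant down to the index set of the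
  -- chains, where E K = 1.
  have hfac : chainMatrix pr F = C * (1 + K * (X - E)) := by
    rw [hZ, Matrix.mul_add, Matrix.mul_one, ← Matrix.mul_assoc, hCK, Matrix.mul_sub, hCdef]
    abel
  rw [hfac, det_mul, hdetC, one_mul, det_one_add_mul_comm, Matrix.sub_mul]
  congr 1
  ext i j
  rw [Matrix.add_apply, Matrix.sub_apply, hK', hK']
  have hE : E i (tail j) = if j = i then 1 else 0 := by simp [E, hribtail]
  have hX : X i (tail j) = F (head i) (tail j) := rfl
  rw [hE, hX, one_apply, of_apply]
  by_cases h : i = j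
  · simp [h]
  · simp [h, Ne.symm h]

/-- Indices outside `p` that split a matrix into triangular blocks can be left out of the
determinant. -/
theorem det_eq_det_of_triangular_outside {n : ℕ} (M : Matrix (Fin n) (Fin n) R)
    (p : Fin n → Prop) [DecidablePred p] (h1 : ∀ e, ¬ p e → M e e = 1)
    (h0 : ∀ e, ¬ p e → ∀ i j, j ≤ e → e ≤ i → j < i → M i j = 0) :
    M.det = Matrix.det (Matrix.of fun i j : {i // p i} => M i j) := by
  classical
  -- `M'` replaces the rows and columns outside `p` by those of the identity; it has the same
  -- diagonal blocks as `M`.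
  let M' : Matrix (Fin n) (Fin n) R := fun i j => if p i ∧ p j then M i j else if i = j then 1 else 0
  have hM'a : ∀ i j, M' i j = if p i ∧ p j then M i j else if i = j then 1 else 0 :=
    fun _ _ => rfl
  let cnt : Fin n → ℕ := fun i => (Finset.univ.filter fun e => ¬ p e ∧ e < i).card
  have hmono : ∀ i j, i ≤ j → cnt i ≤ cnt j := fun i j hij =>
    Finset.card_le_card fun e he => by
      simp only [Finset.mem_filter, Finset.mem_univ, true_and] at he ⊢
      exact ⟨he.1, he.2.trans_le hij⟩
  have hlt : ∀ i j, i < j → ¬ p i → cnt i < cnt j := fun i j hij hi =>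
    Finset.card_lt_card (by
      rw [Finset.ssubset_iff_of_subset]
      · exact ⟨i, by simp [hi, hij], by simp⟩
      · intro e he
        simp only [Finset.mem_filter, Finset.mem_univ, true_and] at he ⊢
        exact ⟨he.1, he.2.trans hij⟩)
  -- Each index outside `p` gets an odd value of its own, and each run of indices between two
  -- consecutive such indices shares an even value.
  let b : Fin n → ℕ := fun i => 2 * cnt i + if p i then 0 else 1
  have hb : ∀ i j, b j < b i → j < i ∧ ∃ e, ¬ p e ∧ j ≤ e ∧ e ≤ i := by
    intro i j hij
    have hji : j < i := by
      by_contra hle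
      rcases (not_lt.mp hle).eq_or_lt with h | h
      · rw [h] at hij; exact lt_irrefl _ hij
      · have h2 := hmono i j h.le
        by_cases hi : p i
        · simp only [b, if_pos hi] at hij; omega
        · have h3 := hlt i j h hi
          simp only [b, if_neg hi] at hij; omega
    refine ⟨hji, ?_⟩
    by_cases hi : p i
    · have h3 : cnt j < cnt i := by
        simp only [b, if_pos hi] at hij; omega
      obtain ⟨e, he, he'⟩ := Finset.exists_mem_notMem_of_card_lt_card h3
      simp only [Finset.mem_filter, Finset.mem_univ, true_and, not_and, not_lt] at he he'
      exact ⟨e, he.1, he' he.1, he.2.le⟩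
    · exact ⟨i, hi, hji.le, le_rfl⟩
  have hM : M.BlockTriangular b := by
    intro i j hij
    obtain ⟨hji, e, he, hje, hei⟩ := hb i j hij
    exact h0 e he i j hje hei hji
  have hM' : M'.BlockTriangular b := by
    intro i j hij
    obtain ⟨hji, e, he, hje, hei⟩ := hb i j hij
    simp only [hM'a, h0 e he i j hje hei hji, if_neg hji.ne', ite_self]
  have hMM : M.det = M'.det := by
    rw [hM.det, hM'.det]
    refine Finset.prod_congr rfl fun a _ => ?_
    congr 1
    ext ⟨i, hi⟩ ⟨j, hj⟩
    simp only [toSquareBlock_def, of_apply, hM'a]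
    have key : ∀ i j : Fin n, b i = b j → ¬ p i → i = j := by
      intro i j hij hi
      rcases lt_trichotomy i j with h | h | h
      · have := hlt i j h hi
        simp only [b, if_neg hi] at hij; split_ifs at hij <;> omega
      · exact h
      · have := hmono j i h.le
        by_cases hj : p j
        · simp only [b, if_neg hi, if_pos hj] at hij; omega
        · have := hlt j i h hj
          simp only [b, if_neg hi, if_neg hj] at hij; omega
    by_cases hij : p i ∧ p j
    · rw [if_pos hij]
    · have hij' : i = j := by
        by_cases hpi : p i
        · exact (key j i (hj.trans hi.symm) fun h => hij ⟨hpi, h⟩).symm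
        · exact key i j (hi.trans hj.symm) hpi
      subst hij'
      rw [if_neg hij, if_pos rfl, h1 i fun h => hij ⟨h, h⟩]
  rw [hMM, twoBlockTriangular_det M' p fun i hi j hj => by
    simp only [hM'a, if_neg fun h : p i ∧ p j => hi h.1]
    exact if_neg fun h => hi (by rw [h]; exact hj)]
  have h2 : M'.toSquareBlockProp (fun i => ¬ p i) = 1 := by
    ext ⟨i, hi⟩ ⟨j, hj⟩
    simp only [toSquareBlockProp_def, of_apply, hM'a, if_neg fun h : p i ∧ p j => hi h.1, one_apply,
      Subtype.mk.injEq]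
  rw [h2, det_one, mul_one]
  congr 1
  ext ⟨i, hi⟩ ⟨j, hj⟩
  simp only [toSquareBlockProp_def, of_apply, hM'a, if_pos (And.intro hi hj)]

end LinearAlgebra

/-! ### Pivoting a unitriangular array, and Hessenberg determinants -/

section Pivots

variable {R : Type*} [CommRing R]

/-- The result of pivoting a unitriangular array successively on the diagonal entries listed in
`L`, with all signs removed. -/
def pivots (U : ℤ → ℤ → R) : List ℤ → ℤ → ℤ → R
  | [], p, q => U p q
  | c :: L, p, q =>
    if p < c ∧ c < q then pivots U L p c * pivots U L c q - pivots U L p q else pivots U L p q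

theorem pivots_self {U : ℤ → ℤ → R} (h1 : ∀ p, U p p = 1) (L : List ℤ) (p : ℤ) :
    pivots U L p p = 1 := by
  induction L with
  | nil => exact h1 p
  | cons c L ih =>
    rw [pivots, if_neg fun h => lt_asymm h.1 h.2, ih]

theorem pivots_of_lt {U : ℤ → ℤ → R} (h0 : ∀ p q, q < p → U p q = 0) (L : List ℤ) {p q : ℤ}
    (h : q < p) : pivots U L p q = 0 := by
  induction L with
  | nil => exact h0 p q h
  | cons c L ih =>
    rw [pivots, if_neg fun h' => absurd (h'.1.trans h'.2) (not_lt.mpr h.le), ih]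

/-- The Hessenberg matrix of the entries with row indices `p, l` and column indices `l, q`. -/
def stripMatrix (U : ℤ → ℤ → R) (p : ℤ) (l : List ℤ) (q : ℤ) :
    Matrix (Fin (l.length + 1)) (Fin (l.length + 1)) R :=
  Matrix.of fun r s => U ((p :: l).getD r 0) ((l ++ [q]).getD s 0)

theorem det_stripMatrix_nil (U : ℤ → ℤ → R) (p q : ℤ) : (stripMatrix U p [] q).det = U p q := by
  refine (Matrix.det_fin_one (stripMatrix U p [] q)).trans ?_
  simp [stripMatrix]

/-- Expansion along the first column: below the entries U(p, c) and U(c, c) = 1 stand U(x, c) with x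
> c, which vanish. -/
theorem det_stripMatrix_cons {U : ℤ → ℤ → R} (h1 : ∀ p, U p p = 1)
    (h0 : ∀ p q, q < p → U p q = 0) (p c : ℤ) (l : List ℤ) (q : ℤ) (hl : ∀ x ∈ l, c < x) :
    (stripMatrix U p (c :: l) q).det =
      U p c * (stripMatrix U c l q).det - (stripMatrix U p l q).det := by
  have hdet : (stripMatrix U p (c :: l) q).det = _ :=
    Matrix.det_succ_column_zero (n := l.length + 1) _
  rw [hdet, Fin.sum_univ_succ, Fin.sum_univ_succ, Finset.sum_eq_zero]
  · have e1 : stripMatrix U p (c :: l) q 0 0 = U p c := by simp [stripMatrix]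
    have e2 : stripMatrix U p (c :: l) q (Fin.succ 0) 0 = 1 := by simp [stripMatrix, h1]
    have e3 : (stripMatrix U p (c :: l) q).submatrix (Fin.succAbove 0) Fin.succ =
        stripMatrix U c l q := by
      ext r s; simp [stripMatrix]
    have e4 : (stripMatrix U p (c :: l) q).submatrix
        (Fin.succAbove (Fin.succ (0 : Fin (l.length + 1)))) Fin.succ = stripMatrix U p l q := by
      ext r s
      refine Fin.cases ?_ (fun r => ?_) r
      · simp [stripMatrix]
      · rw [submatrix_apply, Fin.succ_succAbove_succ, Fin.zero_succAbove]
        simp [stripMatrix]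
    rw [e1, e2, e3, e4]
    simp; ring
  · intro r _
    have hr : (r : ℕ) < l.length := r.2
    have : stripMatrix U p (c :: l) q r.succ.succ 0 = 0 := by
      have h2 : stripMatrix U p (c :: l) q r.succ.succ 0 = U (l.getD r 0) c := by
        simp [stripMatrix]
      rw [h2]
      refine h0 _ _ (hl _ ?_)
      rw [List.getD_eq_getElem _ _ hr]
      exact List.getElem_mem _
    rw [this]; simp

/-- The pivot applied last is the least one, c. No other pivot lies between p and c, so pivoting
leaves U(p, c) alone, and the recursion for `pivots` becomes the expansion in
`det_stripMatrix_cons`. -/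
theorem pivots_eq_det_stripMatrix {U : ℤ → ℤ → R} (h1 : ∀ p, U p p = 1)
    (h0 : ∀ p q, q < p → U p q = 0) (L : List ℤ) (hL : L.Pairwise (· < ·)) (p q : ℤ) :
    pivots U L p q = (stripMatrix U p (L.filter fun x => p < x ∧ x < q) q).det := by
  induction L generalizing p q with
  | nil => rw [List.filter_nil, det_stripMatrix_nil]; rfl
  | cons c L ih =>
    rw [List.pairwise_cons] at hL
    have hfil : ∀ {q'}, q' ≤ c → ∀ p', L.filter (fun x => p' < x ∧ x < q') = [] := by
      intro q' hq' p'
      rw [List.filter_eq_nil_iff]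
      intro x hx
      have := hL.1 x hx
      simp only [decide_eq_true_eq, not_and, not_lt]
      intro _; linarith
    rw [pivots]
    by_cases h : p < c ∧ c < q
    · rw [if_pos h, List.filter_cons_of_pos (by simpa using h), ih hL.2, ih hL.2, ih hL.2,
        hfil le_rfl, det_stripMatrix_nil]
      have h2 : L.filter (fun x => c < x ∧ x < q) = L.filter (fun x => p < x ∧ x < q) := by
        refine List.filter_congr fun x hx => ?_
        have := hL.1 x hx
        simp only [this, h.1.trans this, true_and]
      rw [h2, det_stripMatrix_cons h1 h0]
      intro x hx
      exact hL.1 x (List.mem_filter.mp hx).1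
    · rw [if_neg h, List.filter_cons_of_neg (by simpa using h), ih hL.2]

end Pivots

/-! ### Diagonals of connected skew shapes -/

section Diagonals

/-- In a connected set of cells, two cells on either side of a diagonal line force an adjacent
pair of cells across the line. -/
theorem CellsConnected.exists_step {s : Finset (ℕ × ℕ)} (hs : CellsConnected s) {x z : ℕ × ℕ}
    (hx : x ∈ s) (hz : z ∈ s) {c : ℤ} (hxc : (x.2 : ℤ) - x.1 ≤ c) (hzc : c < (z.2 : ℤ) - z.1) :
    ∃ i j : ℕ, ((i + 1, j) ∈ s ∧ (i, j) ∈ s ∧ (j : ℤ) - (i + 1) = c) ∨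
      ((i, j) ∈ s ∧ (i, j + 1) ∈ s ∧ (j : ℤ) - i = c) := by
  obtain ⟨w⟩ := hs.preconnected ⟨x, hx⟩ ⟨z, hz⟩
  obtain ⟨d, -, hd1, hd2⟩ := w.exists_boundary_dart
    {v | ((v : ℕ × ℕ).2 : ℤ) - ((v : ℕ × ℕ).1 : ℤ) ≤ c} hxc (not_le.mpr hzc)
  obtain ⟨⟨⟨⟨i, j⟩, hv⟩, ⟨⟨i', j'⟩, hv'⟩⟩, hadj⟩ := d
  simp only [Set.mem_ofPred_eq, not_le] at hd1 hd2
  rw [SimpleGraph.comap_adj, SimpleGraph.hasse_adj] at hadj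
  simp only [Function.Embedding.subtype_apply, Prod.covBy_iff, Nat.covBy_iff_add_one_eq] at hadj
  rcases hadj with (⟨h, h'⟩ | ⟨h, h'⟩) | (⟨h, h'⟩ | ⟨h, h'⟩)
  · omega
  · refine ⟨i, j, Or.inr ⟨hv, ?_, by omega⟩⟩
    subst h h'; exact hv'
  · refine ⟨i', j, Or.inl ⟨?_, ?_, by omega⟩⟩
    · subst h h'; exact hv
    · subst h h'; exact hv'
  · omega

namespace RShape

theorem mem_cells {S : RShape} {i j : ℕ} :
    (i, j) ∈ S.cells ↔ i < S.outer.colLen j ∧ S.inner.colLen j ≤ i := by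
  rw [cells, Finset.mem_sdiff, YoungDiagram.mem_cells, YoungDiagram.mem_cells,
    YoungDiagram.mem_iff_lt_colLen, YoungDiagram.mem_iff_lt_colLen, not_lt]

theorem mem_cells_of_between {S : RShape} {i j i₀ j₀ i₁ j₁ : ℕ} (h₀ : (i₀, j₀) ∈ S.cells)
    (h₁ : (i₁, j₁) ∈ S.cells) (hi₀ : i₀ ≤ i) (hj₀ : j₀ ≤ j) (hi₁ : i ≤ i₁) (hj₁ : j ≤ j₁) :
    (i, j) ∈ S.cells := by
  rw [mem_cells] at *
  have := S.outer.colLen_anti j j₁ hj₁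
  have := S.inner.colLen_anti j₀ j hj₀
  omega

/-- Connectedness supplies an edge from the diagonal of the cell to the next one. Its far end lies
either weakly right of the cell and strictly above it, or strictly right and weakly below; if order
is reversed along the diagonal, the same dichotomy holds. Convexity then fills in the neighbour
above or to the right. -/
theorem up_or_right {S : RShape} (hS : CellsConnected S.cells) {i j : ℕ} (hx : (i, j) ∈ S.cells)
    {z : ℕ × ℕ} (hz : z ∈ S.cells) (h : S.content (i, j) < S.content z) :
    (∃ i', i' + 1 = i ∧ (i', j) ∈ S.cells) ∨ (i, j + 1) ∈ S.cells := by
  simp only [content] at h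
  obtain ⟨i', j', h | h⟩ := hS.exists_step hx hz le_rfl (by dsimp only; omega)
  · obtain ⟨h1, h2, h3⟩ := h
    dsimp only at h3
    rcases lt_or_ge i' i with hi | hi
    · left
      obtain ⟨i, rfl⟩ : ∃ i₁, i = i₁ + 1 := ⟨i - 1, by omega⟩
      exact ⟨i, rfl, mem_cells_of_between h2 hx (by omega) (by omega) (by omega) le_rfl⟩
    · right
      exact mem_cells_of_between hx h2 le_rfl (by omega) (by omega) (by omega)
  · obtain ⟨h1, h2, h3⟩ := h
    dsimp only at h3
    rcases lt_or_ge i' i with hi | hi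
    · left
      obtain ⟨i, rfl⟩ : ∃ i₁, i = i₁ + 1 := ⟨i - 1, by omega⟩
      exact ⟨i, rfl, mem_cells_of_between h1 hx (by omega) (by omega) (by omega) le_rfl⟩
    · right
      exact mem_cells_of_between hx h2 le_rfl (by omega) (by omega) (by omega)

theorem below_or_left {S : RShape} (hS : CellsConnected S.cells) {i j : ℕ}
    (hx : (i, j) ∈ S.cells) {z : ℕ × ℕ} (hz : z ∈ S.cells)
    (h : S.content z < S.content (i, j)) :
    (i + 1, j) ∈ S.cells ∨ ∃ j', j' + 1 = j ∧ (i, j') ∈ S.cells := by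
  simp only [content] at h
  obtain ⟨i', j', h | h⟩ := hS.exists_step hz hx (c := (j : ℤ) - i - 1) (by omega)
    (by dsimp only; omega)
  · obtain ⟨h1, h2, h3⟩ := h
    rcases lt_or_ge i i' with hi | hi
    · left
      exact mem_cells_of_between hx h2 (by omega) (by omega) (by omega) (by omega)
    · rcases hi.eq_or_lt with rfl | hi
      · left; obtain rfl : j' = j := by omega
        exact h1
      · right
        obtain ⟨j, rfl⟩ : ∃ j₁, j = j₁ + 1 := ⟨j - 1, by omega⟩
        exact ⟨j, rfl, mem_cells_of_between h1 hx (by omega) (by omega) (by omega) (by omega)⟩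
  · obtain ⟨h1, h2, h3⟩ := h
    rcases lt_or_ge i i' with hi | hi
    · left
      exact mem_cells_of_between hx h2 (by omega) (by omega) (by omega) (by omega)
    · right
      obtain ⟨j, rfl⟩ : ∃ j₁, j = j₁ + 1 := ⟨j - 1, by omega⟩
      exact ⟨j, rfl, mem_cells_of_between h1 hx (by omega) (by omega) (by omega) (by omega)⟩

/-- The predecessor relation of cells: the predecessor of a cell is the cell to its left if its
content is in `L`, and the cell below it otherwise. -/
def IsPred (S : RShape) (L : List ℤ) (y x : S.cells) : Prop :=
  if S.content x ∈ L then (y : ℕ × ℕ).1 = (x : ℕ × ℕ).1 ∧ (y : ℕ × ℕ).2 + 1 = (x : ℕ × ℕ).2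
  else (y : ℕ × ℕ).1 = (x : ℕ × ℕ).1 + 1 ∧ (y : ℕ × ℕ).2 = (x : ℕ × ℕ).2

theorem IsPred.content_eq {S : RShape} {L : List ℤ} {y x : S.cells} (h : S.IsPred L y x) :
    S.content y + 1 = S.content x := by
  unfold IsPred at h
  simp only [content]
  split_ifs at h <;> omega

/-- Packages a neighbouring cell that may fail to exist, so that the cases of `det_pivot` can be
split on it. -/
theorem exists_option_iff {α : Type*} (P : α → Prop) (h : ∀ x y, P x → P y → x = y) :
    ∃ o : Option α, ∀ b, o = some b ↔ P b := by
  by_cases hP : ∃ x, P x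
  · obtain ⟨x, hx⟩ := hP
    exact ⟨some x, fun b => ⟨fun e => (Option.some.inj e) ▸ hx, fun hb => by rw [h x b hx hb]⟩⟩
  · exact ⟨none, fun b => ⟨fun e => (Option.some_ne_none b e.symm).elim, fun hb => (hP ⟨b, hb⟩).elim⟩⟩

/-- The diagonal through a cell: it consists of the cells `(i + k, j + k)` with `k ≤ N`. -/
theorem exists_diagonal {S : RShape} {x : ℕ × ℕ} (hx : x ∈ S.cells) :
    ∃ i j N : ℕ, S.content (i, j) = S.content x ∧ (∀ k ≤ N, (i + k, j + k) ∈ S.cells) ∧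
      ∀ v ∈ S.cells, S.content v = S.content x → ∃ k ≤ N, v = (i + k, j + k) := by
  have hne : (S.diagonal (S.content x)).Nonempty := ⟨x, by simp [diagonal, hx]⟩
  obtain ⟨⟨i, j⟩, h0, hmin⟩ := Finset.exists_min_image _ (fun v => v.1) hne
  obtain ⟨⟨i', j'⟩, h1, hmax⟩ := Finset.exists_max_image _ (fun v => v.1) hne
  simp only [diagonal, Finset.mem_filter] at h0 h1 hmin hmax
  have hii := hmin _ h1
  have hc0 := h0.2
  have hc1 := h1.2
  simp only [content] at hc0 hc1
  dsimp only at hii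
  refine ⟨i, j, i' - i, h0.2, fun k hk => ?_, fun v hv hvc => ?_⟩
  · exact mem_cells_of_between h0.1 h1.1 (by omega) (by omega) (by omega) (by omega)
  · have h2 := hmin v ⟨hv, hvc⟩
    have h3 := hmax v ⟨hv, hvc⟩
    simp only [content] at hvc
    refine ⟨v.1 - i, by omega, Prod.ext ?_ ?_⟩ <;> dsimp only <;> omega

end RShape
end Diagonals

/-! ### Changing the direction of one diagonal amounts to a pivot -/

namespace RShape

variable {R : Type*} [CommRing R]

/-- The chain matrix on the cells of `S` for the predecessor relation given by `L` and the array
pivoted on `L`. -/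
noncomputable def cellMatrix (S : RShape) (U : ℤ → ℤ → R) (L : List ℤ) :
    Matrix S.cells S.cells R :=
  chainMatrix (S.IsPred L) fun x y => pivots U L (S.content x) (S.content y + 1)

theorem isPred_of_mem {S : RShape} {L : List ℤ} {x y : S.cells} (h : S.content x ∈ L) :
    S.IsPred L y x ↔ (y : ℕ × ℕ).1 = (x : ℕ × ℕ).1 ∧ (y : ℕ × ℕ).2 + 1 = (x : ℕ × ℕ).2 := by
  rw [IsPred, if_pos h]

theorem isPred_of_notMem {S : RShape} {L : List ℤ} {x y : S.cells} (h : S.content x ∉ L) :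
    S.IsPred L y x ↔ (y : ℕ × ℕ).1 = (x : ℕ × ℕ).1 + 1 ∧ (y : ℕ × ℕ).2 = (x : ℕ × ℕ).2 := by
  rw [IsPred, if_neg h]

/-- Adding `c` to the list changes only two things: the predecessors on the diagonal of content c,
and the array, by a pivot at (c, c). After a change of signs this is the situation of `det_pivot`.
-/
theorem det_cellMatrix_cons {S : RShape} (hS : CellsConnected S.cells) {U : ℤ → ℤ → R}
    (h1 : ∀ p, U p p = 1) (h0 : ∀ p q, q < p → U p q = 0) {c : ℤ} {L : List ℤ} (hc : c ∉ L)
    (hx : ∃ x ∈ S.cells, S.content x = c) :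
    (S.cellMatrix U (c :: L)).det = (S.cellMatrix U L).det := by
  classical
  obtain ⟨x, hx, rfl⟩ := hx
  obtain ⟨i, j, N, hij, hdiag, hdiag'⟩ := exists_diagonal hx
  set c := S.content x with hcdef
  -- The cells of content c from top left to bottom right. Next, `y` lists the cells of content c -
  -- 1 between them, and `l`, `m` are the possible ones at the two ends.
  let u : Fin (N + 1) ↪ S.cells :=
    ⟨fun k => ⟨(i + k, j + k), hdiag k (Nat.lt_succ_iff.mp k.2)⟩, fun k k' h => by
      have := congrArg (fun v : S.cells => (v : ℕ × ℕ).1) h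
      exact Fin.ext (Nat.add_left_cancel this)⟩
  have hu : ∀ k, (u k : ℕ × ℕ) = (i + k, j + k) := fun k => rfl
  have huc : ∀ k, S.content (u k) = c := fun k => by
    rw [hu, ← hij]; simp only [content]; push_cast; ring
  let y : Fin N → S.cells := fun k => ⟨(i + k + 1, j + k),
    mem_cells_of_between (hdiag k k.2.le) (hdiag (k + 1) k.2) (by omega) (by omega) (by omega)
      (by omega)⟩
  have hy : ∀ k, (y k : ℕ × ℕ) = (i + k + 1, j + k) := fun k => rfl
  obtain ⟨l, hl⟩ := exists_option_iff
    (fun b : S.cells => (b : ℕ × ℕ).1 = i ∧ (b : ℕ × ℕ).2 + 1 = j) (fun a b ha hb =>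
      Subtype.ext (Prod.ext (by omega) (by omega)))
  obtain ⟨m, hm⟩ := exists_option_iff
    (fun b : S.cells => (b : ℕ × ℕ).1 = i + N + 1 ∧ (b : ℕ × ℕ).2 = j + N) (fun a b ha hb =>
      Subtype.ext (Prod.ext (by omega) (by omega)))
  have hyb : ∀ k b, y k = b ↔ (b : ℕ × ℕ).1 = i + k + 1 ∧ (b : ℕ × ℕ).2 = j + k := fun k b => by
    rw [Subtype.ext_iff, hy, Prod.ext_iff]; dsimp only; omega
  have hcx : c = (j : ℤ) - i + S.root - 1 + S.outer.colLen 0 := by rw [← hij]; rfl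
  have hcb : ∀ b : S.cells, S.content b + 1 = c ↔ (b : ℕ × ℕ).2 + 1 + i = (b : ℕ × ℕ).1 + j := by
    intro b
    rw [hcx]; simp only [content]; omega
  have hlc : ∀ b, l = some b → S.content b + 1 = c := fun b hb => by
    rw [hl] at hb; rw [hcb]; omega
  have hmc : ∀ b, m = some b → S.content b + 1 = c := fun b hb => by
    rw [hm] at hb; rw [hcb]; omega
  have hyc : ∀ k, S.content (y k) + 1 = c := fun k => by rw [hcb, hy]; dsimp only; omega
  have hsurj : ∀ p : S.cells, p ∉ Set.range u → S.content p ≠ c := by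
    intro p hp hpc
    obtain ⟨k, hk, hpk⟩ := hdiag' p p.2 hpc
    exact hp ⟨⟨k, Nat.lt_succ_iff.mpr hk⟩, Subtype.ext hpk.symm⟩
  -- the predecessors in the two relations
  have hpl : ∀ b, S.IsPred (c :: L) b (u 0) ↔ l = some b := fun b => by
    rw [isPred_of_mem (by rw [huc]; exact List.mem_cons_self), hl, hu]
    simp
  have hpm : ∀ b, S.IsPred L b (u (Fin.last N)) ↔ m = some b := fun b => by
    rw [isPred_of_notMem (by rwa [huc]), hm, hu]
    simp
  have hpy : ∀ k b, S.IsPred (c :: L) b (u k.succ) ↔ y k = b := fun k b => by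
    rw [isPred_of_mem (by rw [huc]; exact List.mem_cons_self), hyb, hu]
    simp only [Fin.val_succ]; omega
  have hpy' : ∀ (k : Fin N) b, S.IsPred L b (u k.castSucc) ↔ y k = b := fun k b => by
    rw [isPred_of_notMem (by rwa [huc]), hyb, hu]
    simp only [Fin.val_castSucc]
  have hpp : ∀ p : S.cells, S.content p ≠ c → ∀ b, S.IsPred (c :: L) b p ↔ S.IsPred L b p := by
    intro p hp b
    by_cases h : S.content p ∈ L
    · rw [isPred_of_mem h, isPred_of_mem (List.mem_cons_of_mem _ h)]
    · rw [isPred_of_notMem h, isPred_of_notMem (by simp [h, hp])]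
  -- `pivots` has its signs removed; σ and τ put them back. A cell of content p carries σ(p) as a
  -- row and τ(p + 1) as a column, with product 1, so the determinant does not change.
  let σ : ℤ → R := fun p => if p < c then 1 else -1
  let τ : ℤ → R := fun q => if q ≤ c then 1 else -1
  have hσc : σ c = -1 := if_neg (lt_irrefl c)
  have hτc : τ c = 1 := if_pos le_rfl
  have hστ : ∀ p, p ≠ c → σ p * τ p = 1 := by
    intro p hp
    rcases lt_or_gt_of_ne hp with h | h
    · simp only [σ, τ, if_pos h, if_pos h.le, one_mul]
    · simp only [σ, τ, if_neg h.not_gt, if_neg h.not_ge]; ring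
  have hστ' : ∀ p, σ p * τ (p + 1) = 1 := by
    intro p
    rcases lt_or_ge p c with h | h
    · simp only [σ, τ, if_pos h, if_pos (Int.add_one_le_iff.mpr h), one_mul]
    · simp only [σ, τ, if_neg h.not_gt, if_neg (Int.lt_add_one_iff.mpr h).not_ge]; ring
  let P := pivots U L
  have hP1 : ∀ p, P p p = 1 := pivots_self h1 L
  have hP0 : ∀ {p q}, q < p → P p q = 0 := fun h => pivots_of_lt h0 L h
  -- Row c of the array is split as w + e, where e holds the diagonal entry 1. `X` is column c of
  -- the array, restricted to the heads off the diagonal.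
  let w : S.cells → R := fun b => if S.content b + 1 = c then 0 else P c (S.content b + 1)
  let e : S.cells → R := fun b => if S.content b + 1 = c then 1 else 0
  let X : S.cells → R := fun p =>
    if S.content p = c ∨ ∃ v, S.IsPred L v p then 0 else P (S.content p) c
  let C : Matrix S.cells S.cells R := Matrix.of fun p b => σ (S.content p) *
    (Matrix.of fun (p b : S.cells) => τ (S.content b + 1) * S.cellMatrix U (c :: L) p b) p b
  have hCa : ∀ p b, C p b =
    σ (S.content p) * (τ (S.content b + 1) * S.cellMatrix U (c :: L) p b) := fun _ _ => rfl
  have hC : C.det = (S.cellMatrix U (c :: L)).det := by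
    rw [det_mul_column, det_mul_row, ← mul_assoc, ← Finset.prod_mul_distrib,
      Finset.prod_eq_one fun p _ => hστ' _, one_mul]
  have hcell : ∀ L' p b, S.cellMatrix U L' p b = if ∃ v, S.IsPred L' v p then
      (if S.IsPred L' b p then -1 else 0) else pivots U L' (S.content p) (S.content b + 1) :=
    fun L' p b => rfl
  rw [← hC]
  refine det_pivot u y l m _ C w e X ?_ ?_ ?_ ?_ ?_ ?_ ?_ ?_ ?_ ?_ ?_ ?_
  · intro b
    by_cases hb : S.content b + 1 = c
    -- Connectedness gives a cell of content c - 1 a neighbour of content c above or to its right.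
    -- Hence it is `l`, `m` or one of the `y k`, and its row number tells which.
    · have hstep : i ≤ (b : ℕ × ℕ).1 ∧ (b : ℕ × ℕ).1 ≤ i + N + 1 := by
        rcases up_or_right hS (i := (b : ℕ × ℕ).1) (j := (b : ℕ × ℕ).2) b.2 hx (by rw [← hcdef, ← hb]; exact lt_add_one (S.content b))
          with ⟨a, ha, hmem⟩ | hmem
        · obtain ⟨k, hk, hk'⟩ := hdiag' _ hmem
            (by rw [← hb]; simp only [content]; push_cast [← ha]; ring)
          have := congrArg Prod.fst hk'
          dsimp only at this
          omega
        · obtain ⟨k, hk, hk'⟩ := hdiag' _ hmem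
            (by rw [← hb]; simp only [content]; push_cast; ring)
          have := congrArg Prod.fst hk'
          dsimp only at this
          omega
      have hbc := (hcb b).mp hb
      simp only [e, if_pos hb, hl, hm, hyb]
      rcases hstep.1.eq_or_lt with h | h
      · rw [if_pos (by omega), if_neg (by omega), Finset.sum_eq_zero]
        · simp
        · intro k _; exact if_neg (by omega)
      · rcases hstep.2.eq_or_lt with h' | h'
        · rw [if_neg (by omega), if_pos (by omega), Finset.sum_eq_zero]
          · simp
          · intro k _; exact if_neg (by omega)
        · rw [if_neg (by omega), if_neg (by omega),
            Finset.sum_eq_single ⟨(b : ℕ × ℕ).1 - i - 1, by omega⟩]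
          · rw [if_pos (by dsimp only; omega)]; simp
          · intro k _ hk
            refine if_neg fun h2 => hk (Fin.ext ?_)
            dsimp only; omega
          · simp
    · rw [Finset.sum_eq_zero fun k _ => if_neg fun h : y k = b => hb (h ▸ hyc k),
        if_neg fun h => hb (hlc b h), if_neg fun h => hb (hmc b h)]
      simp only [e, if_neg hb, add_zero]
  · intro b hb hb'
    rw [hl] at hb; rw [hm] at hb'; omega
  · intro k h
    rw [hl, hy] at h; dsimp only at h; omega
  · intro k h
    rw [hm, hy] at h; dsimp only at h; omega
  · intro p hp b hb
    have hbc : S.content b + 1 = c := hb.elim (hlc b) (hmc b)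
    have hpc := hsurj p hp
    rw [hcell]
    by_cases h : ∃ v, S.IsPred L v p
    · rw [if_pos h, if_neg fun h' => hpc (h'.content_eq.symm.trans hbc)]
      simp only [X, if_pos (Or.inr h)]
    · rw [if_neg h, hbc]
      simp only [X, if_neg (not_or.mpr ⟨hpc, h⟩), P]
  · intro k
    exact if_pos (Or.inl (huc k))
  · intro b hb
    exact if_pos (hb.elim (hlc b) (hmc b))
  · intro p hp b
    have hpc := hsurj p hp
    rw [hCa, hcell, hcell]
    simp only [hpp p hpc]
    by_cases h : ∃ v, S.IsPred L v p
    · simp only [if_pos h, X, if_pos (Or.inr h : S.content p = c ∨ _), zero_mul, sub_zero]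
      by_cases h' : S.IsPred L b p
      · rw [if_pos h', h'.content_eq, ← mul_assoc, hστ _ hpc, one_mul]
      · simp [h']
    · simp only [if_neg h, X, if_neg (not_or.mpr ⟨hpc, h⟩), w]
      -- What remains is σ(p) τ(q) P'(p, q) = P(p, q) - P(p, c) w(q) for p ≠ c, by the position of p
      -- and q relative to c.
      generalize S.content p = p at hpc
      generalize S.content b + 1 = q
      rw [pivots]
      change σ p * (τ q * if p < c ∧ c < q then P p c * P c q - P p q else P p q) = P p q - _
      rcases lt_or_gt_of_ne hpc with hp | hp
      · rcases lt_trichotomy q c with hq | hq | hq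
        · rw [if_neg (by omega), if_neg hq.ne, hP0 hq]
          simp only [σ, τ, if_pos hp, if_pos hq.le]; ring
        · rw [if_neg (by omega), if_pos hq]
          simp only [σ, τ, if_pos hp, if_pos hq.le]; ring
        · rw [if_pos ⟨hp, hq⟩, if_neg hq.ne']
          simp only [σ, τ, if_pos hp, if_neg hq.not_ge]; ring
      · rw [if_neg (by omega), hP0 hp]
        rcases lt_or_ge c q with hq | hq
        · simp only [σ, τ, if_neg hp.not_gt, if_neg hq.not_ge]; ring
        · rw [hP0 (hq.trans_lt hp)]; ring
  · intro k b
    rw [hcell, if_pos ⟨y k, (hpy' k _).mpr rfl⟩]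
    simp only [hpy']
    split_ifs <;> simp
  · intro k b
    rw [hCa, hcell, if_pos ⟨y k, (hpy k _).mpr rfl⟩, huc, hσc]
    simp only [hpy]
    split_ifs with h
    · rw [← h, hyc, hτc]; ring
    · ring
  · intro b
    rw [hcell]
    simp only [hpm, ← Option.isSome_iff_exists.trans (exists_congr fun _ => Iff.rfl)]
    split_ifs with h1 h2 <;> try simp
    rw [huc]
    by_cases hb : S.content b + 1 = c
    · simp only [w, e, if_pos hb, hb, zero_add]; exact hP1 c
    · simp only [w, e, if_neg hb, add_zero, P]
  · intro b
    rw [hCa, hcell]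
    simp only [hpl, ← Option.isSome_iff_exists.trans (exists_congr fun _ => Iff.rfl), huc, hσc]
    split_ifs with h1 h2
    · rw [hlc b h2, hτc]; ring
    · ring
    · simp only [w, e]
      generalize S.content b + 1 = q
      rw [pivots, if_neg fun h => lt_irrefl _ h.1]
      change -1 * (τ q * P c q) = _
      rcases lt_trichotomy q c with hq | hq | hq
      · rw [hP0 hq, if_neg hq.ne, if_neg hq.ne]; ring
      · rw [if_pos hq, if_pos hq, hq, hτc, hP1]; ring
      · rw [if_neg hq.ne', if_neg hq.ne']
        simp only [τ, if_neg hq.not_ge]; ring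

/-- Pivoting does not change the determinant of the cell matrix. -/
theorem det_cellMatrix {S : RShape} (hS : CellsConnected S.cells) {U : ℤ → ℤ → R}
    (h1 : ∀ p, U p p = 1) (h0 : ∀ p q, q < p → U p q = 0) {L : List ℤ} (hL : L.Nodup)
    (hx : ∀ c ∈ L, ∃ x ∈ S.cells, S.content x = c) :
    (S.cellMatrix U L).det = (S.cellMatrix U []).det := by
  induction L with
  | nil => rfl
  | cons c L ih =>
    rw [List.nodup_cons] at hL
    rw [det_cellMatrix_cons hS h1 h0 hL.1 (hx c List.mem_cons_self),
      ih hL.2 fun d hd => hx d (List.mem_cons_of_mem _ hd)]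

end RShape

/-! ### Flags as functions of the content, and the decomposition into columns -/

section SuperElem

variable {R : Type*} [CommRing R]

theorem superElem_zero (s t : Finset ℤ) (y z : ℤ → R) : superElem 0 s y t z = 1 := by
  simp only [superElem, elemSymm, homSymm]
  simp
  rfl

theorem superElem_of_neg {n : ℤ} (hn : n < 0) (s t : Finset ℤ) (y z : ℤ → R) :
    superElem n s y t z = 0 := if_pos hn

end SuperElem

namespace RShape

variable {R : Type*} [CommRing R]

/-- A diagonal is a chain, so the componentwise infimum in the definition is attained at its first
cell. -/
theorem leftmost_spec {S : RShape} {x : ℕ × ℕ} (hx : x ∈ S.cells) :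
    S.leftmost (S.content x) ∈ S.cells ∧ S.content (S.leftmost (S.content x)) = S.content x ∧
      ∀ v ∈ S.cells, S.content v = S.content x → S.leftmost (S.content x) ≤ v := by
  obtain ⟨i, j, N, hij, hdiag, hdiag'⟩ := exists_diagonal hx
  have hne : (S.diagonal (S.content x)).Nonempty := ⟨x, by simp [diagonal, hx]⟩
  have h0 : (i, j) ∈ S.cells := hdiag 0 (Nat.zero_le _)
  have hmin : ∀ v ∈ S.cells, S.content v = S.content x → (i, j) ≤ v := by
    intro v hv hvc
    obtain ⟨k, -, rfl⟩ := hdiag' v hv hvc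
    exact ⟨Nat.le_add_right _ _, Nat.le_add_right _ _⟩
  have h : S.leftmost (S.content x) = (i, j) := by
    rw [leftmost, dif_pos hne]
    refine le_antisymm (Finset.inf'_le _ (by simp [diagonal, h0, hij])) ?_
    refine Finset.le_inf' _ _ fun v hv => ?_
    simp only [diagonal, Finset.mem_filter] at hv
    exact hmin v hv.1 hv.2
  rw [h]
  exact ⟨h0, hij, hmin⟩

theorem rightmost_spec {S : RShape} {x : ℕ × ℕ} (hx : x ∈ S.cells) :
    S.rightmost (S.content x) ∈ S.cells ∧ S.content (S.rightmost (S.content x)) = S.content x ∧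
      ∀ v ∈ S.cells, S.content v = S.content x → v ≤ S.rightmost (S.content x) := by
  obtain ⟨i, j, N, hij, hdiag, hdiag'⟩ := exists_diagonal hx
  have hne : (S.diagonal (S.content x)).Nonempty := ⟨x, by simp [diagonal, hx]⟩
  have h0 : (i + N, j + N) ∈ S.cells := hdiag N le_rfl
  have h0c : S.content (i + N, j + N) = S.content x := by
    rw [← hij]; simp only [content]; push_cast; ring
  have hmax : ∀ v ∈ S.cells, S.content v = S.content x → v ≤ (i + N, j + N) := by
    intro v hv hvc
    obtain ⟨k, hk, rfl⟩ := hdiag' v hv hvc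
    exact ⟨Nat.add_le_add_left hk _, Nat.add_le_add_left hk _⟩
  have h : S.rightmost (S.content x) = (i + N, j + N) := by
    rw [rightmost, dif_pos hne]
    refine le_antisymm ?_ (Finset.le_sup' (f := id) (by simp [diagonal, h0, h0c]))
    refine Finset.sup'_le _ _ fun v hv => ?_
    simp only [diagonal, Finset.mem_filter] at hv
    exact hmax v hv.1 hv.2
  rw [h]
  exact ⟨h0, h0c, hmax⟩

/-- An earlier cell on the same diagonal would, by convexity, put the cell above into the shape. -/
theorem leftmost_eq_self {S : RShape} {i j : ℕ} (hx : (i, j) ∈ S.cells)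
    (htop : ∀ i', i' + 1 = i → (i', j) ∉ S.cells) : S.leftmost (S.content (i, j)) = (i, j) := by
  obtain ⟨h1, h2, h3⟩ := leftmost_spec hx
  generalize S.leftmost (S.content (i, j)) = v at h1 h2 h3
  have h4 := h3 _ hx rfl
  have h5 : v.1 ≤ i := h4.1
  have h6 : v.2 ≤ j := h4.2
  simp only [content] at h2
  rcases h5.eq_or_lt with h | h
  · exact Prod.ext h (by dsimp only; omega)
  · exact absurd (mem_cells_of_between h1 hx (by omega) h6 (by omega) le_rfl)
      (htop (i - 1) (by omega))

theorem rightmost_eq_self {S : RShape} {i j : ℕ} (hx : (i, j) ∈ S.cells)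
    (hbot : (i + 1, j) ∉ S.cells) : S.rightmost (S.content (i, j)) = (i, j) := by
  obtain ⟨h1, h2, h3⟩ := rightmost_spec hx
  generalize S.rightmost (S.content (i, j)) = v at h1 h2 h3
  have h4 := h3 _ hx rfl
  have h5 : i ≤ v.1 := h4.1
  have h6 : j ≤ v.2 := h4.2
  simp only [content] at h2
  rcases h5.eq_or_lt with h | h
  · exact Prod.ext h.symm (by dsimp only; omega)
  · exact absurd (mem_cells_of_between hx h1 (by omega) le_rfl (by omega) h6) hbot

/-- The lower flag as a function of the content. -/
noncomputable def lowerAt (S : RShape) (a : ℕ → ℤ) (c : ℤ) : ℤ := a (S.leftmost c).2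

/-- The upper flag as a function of the content. -/
noncomputable def upperAt (S : RShape) (b : ℕ → ℤ) (c : ℤ) : ℤ :=
  b (S.rightmost c).2 - (S.outer.colLen (S.rightmost c).2 : ℤ) + (((S.rightmost c).1 : ℤ) + 1)

/-- The flagged supersymmetric Schur function of a single column with contents `p, …, q - 1`. -/
noncomputable def columnEntry (S : RShape) (a b : ℕ → ℤ) (y z : ℤ → R) (p q : ℤ) : R :=
  superElem (q - p) (Finset.Icc (S.lowerAt a (q - 1)) (S.upperAt b p)) y
    (Finset.Icc (S.lowerAt a (q - 1) + (q - 1)) (S.upperAt b p + p)) z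

theorem columnEntry_self (S : RShape) (a b : ℕ → ℤ) (y z : ℤ → R) (p : ℤ) :
    S.columnEntry a b y z p p = 1 := by
  rw [columnEntry, sub_self, superElem_zero]

theorem columnEntry_of_lt (S : RShape) (a b : ℕ → ℤ) (y z : ℤ → R) (p q : ℤ) (h : q < p) :
    S.columnEntry a b y z p q = 0 := superElem_of_neg (by omega) _ _ _ _

theorem inner_colLen_le (S : RShape) (j : ℕ) : S.inner.colLen j ≤ S.outer.colLen j := by
  by_contra! h
  have h1 : (S.outer.colLen j, j) ∈ S.inner := YoungDiagram.mem_iff_lt_colLen.mpr h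
  exact lt_irrefl _ (YoungDiagram.mem_iff_lt_colLen.mp (S.inner_le h1))

theorem topCell_mem {S : RShape} {j : ℕ} (h : S.inner.colLen j < S.outer.colLen j) :
    S.topCell j ∈ S.cells := mem_cells.mpr ⟨h, le_rfl⟩

theorem bottomCell_mem {S : RShape} {j : ℕ} (h : S.inner.colLen j < S.outer.colLen j) :
    S.bottomCell j ∈ S.cells := mem_cells.mpr ⟨by omega, by omega⟩

/-- Together with `upperAt_bottomCell` this recovers the given flags from functions of the content,
so that the columns of the shape and those of the ribbons use the same array. -/
theorem lowerAt_topCell {S : RShape} (a : ℕ → ℤ) {j : ℕ}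
    (h : S.inner.colLen j < S.outer.colLen j) : S.lowerAt a (S.content (S.topCell j)) = a j := by
  rw [lowerAt, topCell, leftmost_eq_self (topCell_mem h)]
  intro i' hi'
  rw [mem_cells]
  omega

theorem upperAt_bottomCell {S : RShape} (b : ℕ → ℤ) {j : ℕ}
    (h : S.inner.colLen j < S.outer.colLen j) :
    S.upperAt b (S.content (S.bottomCell j)) = b j := by
  rw [upperAt, bottomCell, rightmost_eq_self (bottomCell_mem h)]
  · dsimp only; omega
  · rw [mem_cells]; omega

/-- The determinant of the cell matrix without pivots, by the decomposition into columns. -/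
theorem flaggedSchur_eq_det_cellMatrix (S : RShape) {n : ℕ} (hn : S.width ≤ n) (a b : ℕ → ℤ)
    (y z : ℤ → R) :
    S.flaggedSchur n a b y z = (S.cellMatrix (S.columnEntry a b y z) []).det := by
  have hlt : ∀ x : S.cells, (x : ℕ × ℕ).2 < n := by
    intro x
    have h1 : ((x : ℕ × ℕ).1, (x : ℕ × ℕ).2) ∈ S.cells := x.2
    rw [mem_cells] at h1
    have h2 : (0, (x : ℕ × ℕ).2) ∈ S.outer := YoungDiagram.mem_iff_lt_colLen.mpr (by omega)
    exact (YoungDiagram.mem_iff_lt_rowLen.mp h2).trans_le hn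
  have hcol : ∀ x : S.cells, (x : ℕ × ℕ).1 < S.outer.colLen (x : ℕ × ℕ).2 ∧
      S.inner.colLen (x : ℕ × ℕ).2 ≤ (x : ℕ × ℕ).1 := fun x =>
    mem_cells.mp (show ((x : ℕ × ℕ).1, (x : ℕ × ℕ).2) ∈ S.cells from x.2)
  have hpred : ∀ x w : S.cells, S.IsPred [] w x ↔
      (w : ℕ × ℕ).1 = (x : ℕ × ℕ).1 + 1 ∧ (w : ℕ × ℕ).2 = (x : ℕ × ℕ).2 := fun x w =>
    isPred_of_notMem List.not_mem_nil
  let p : Fin n → Prop := fun j => S.inner.colLen j < S.outer.colLen j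
  let bot : {j // p j} → S.cells := fun j => ⟨S.bottomCell j, bottomCell_mem j.2⟩
  let top : {j // p j} → S.cells := fun j => ⟨S.topCell j, topCell_mem j.2⟩
  have hbot : ∀ j, (bot j : ℕ × ℕ) = (S.outer.colLen j - 1, (j : ℕ)) := fun _ => rfl
  have htop : ∀ j, (top j : ℕ × ℕ) = (S.inner.colLen j, (j : ℕ)) := fun _ => rfl
  rw [cellMatrix, det_chainMatrix (S.IsPred []) _ (fun x => S.content x)
    (fun x => (⟨⟨(x : ℕ × ℕ).2, hlt x⟩, (hcol x).2.trans_lt (hcol x).1⟩ : {j // p j})) bot top]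
  -- Empty columns are dropped: at such an e the diagonal entry has degree 0, and for j ≤ e ≤ i with
  -- j < i the degree is at most j - i < 0.
  · rw [flaggedSchur, det_eq_det_of_triangular_outside _ p]
    · congr 1
      ext ⟨i, hi⟩ ⟨j, hj⟩
      simp only [of_apply, pivots, columnEntry, bot, top, add_sub_cancel_right,
        lowerAt_topCell a hj, upperAt_bottomCell b hi]
      have h1 : p i := hi
      have h2 : ((S.outer.colLen i - 1 : ℕ) : ℤ) = (S.outer.colLen i : ℤ) - 1 := by
        have : S.inner.colLen i < S.outer.colLen i := hi
        omega
      congr 1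
      · simp only [content, topCell, bottomCell, h2]; ring
      · congr 1
        simp only [conjUpper, content, bottomCell, h2]
    · intro e he
      have h1 : S.outer.colLen e = S.inner.colLen e :=
        le_antisymm (not_lt.mp he) (S.inner_colLen_le e)
      rw [of_apply, h1]
      convert superElem_zero _ _ y z using 2
      ring
    · intro e he i j hje hei hji
      rw [of_apply]
      have h1 : S.outer.colLen e = S.inner.colLen e :=
        le_antisymm (not_lt.mp he) (S.inner_colLen_le e)
      have h2 := S.outer.colLen_anti e i hei
      have h3 := S.inner.colLen_anti j e hje
      have h4 : (j : ℕ) < i := hji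
      exact superElem_of_neg (by omega) _ _ _ _
  · intro x w h
    have := h.content_eq
    omega
  · intro x w w' h h'
    rw [hpred] at h h'
    exact Subtype.ext (Prod.ext (by omega) (by omega))
  · intro x x' w h h'
    rw [hpred] at h h'
    exact Subtype.ext (Prod.ext (by omega) (by omega))
  · intro x w h
    rw [hpred] at h
    exact Subtype.ext (Fin.ext h.2)
  · intro x
    rw [Subtype.ext_iff, hbot, Prod.ext_iff]
    have hx := hcol x
    constructor
    · intro h
      refine ⟨?_, rfl⟩
      by_contra hne
      dsimp only at hne
      exact h ⟨⟨((x : ℕ × ℕ).1 + 1, (x : ℕ × ℕ).2), mem_cells.mpr (by omega)⟩,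
        (hpred _ _).mpr ⟨rfl, rfl⟩⟩
    · rintro ⟨h, -⟩ ⟨w, hw⟩
      rw [hpred] at hw
      have hw' := hcol w
      rw [hw.1, hw.2] at hw'
      dsimp only at h
      omega
  · intro j; rfl
  · intro x
    rw [Subtype.ext_iff, htop, Prod.ext_iff]
    have hx := hcol x
    constructor
    · intro h
      refine ⟨?_, rfl⟩
      by_contra hne
      dsimp only at hne
      exact h ⟨⟨((x : ℕ × ℕ).1 - 1, (x : ℕ × ℕ).2), mem_cells.mpr (by omega)⟩,
        (hpred _ _).mpr ⟨by dsimp only; omega, rfl⟩⟩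
    · rintro ⟨h, -⟩ ⟨w, hw⟩
      rw [hpred] at hw
      have hw' := hcol w
      rw [← hw.2] at hw'
      dsimp only at h
      omega
  · intro j; rfl

end RShape

/-! ### Ribbons and outer decompositions -/

namespace IsRibbon

/-- Contents separate the cells of a ribbon: two cells on one diagonal would span a 2 × 2 block by
convexity. -/
theorem eq_of_diagonal {s : Finset (ℕ × ℕ)} (hs : IsRibbon s) {x w : ℕ × ℕ} (hx : x ∈ s)
    (hw : w ∈ s) (h : (x.2 : ℤ) - x.1 = (w.2 : ℤ) - w.1) : x = w := by
  have key : ∀ {x w : ℕ × ℕ}, x ∈ s → w ∈ s → (x.2 : ℤ) - x.1 = (w.2 : ℤ) - w.1 →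
      ¬ x.1 < w.1 := by
    intro x w hx hw h hlt
    have hmem : ∀ i j, x.1 ≤ i → i ≤ x.1 + 1 → x.2 ≤ j → j ≤ x.2 + 1 → (i, j) ∈ s := by
      intro i j h1 h2 h3 h4
      exact hs.skew.out hx hw ⟨⟨h1, h3⟩, ⟨by dsimp only; omega, by dsimp only; omega⟩⟩
    exact hs.no_block x.1 x.2 ⟨hmem _ _ (by omega) (by omega) (by omega) (by omega),
      hmem _ _ (by omega) (by omega) (by omega) (by omega),
      hmem _ _ (by omega) (by omega) (by omega) (by omega),
      hmem _ _ (by omega) (by omega) (by omega) (by omega)⟩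
  have h1 := key hx hw h
  have h2 := key hw hx h.symm
  exact Prod.ext (by omega) (by omega)

theorem up_or_right {s : Finset (ℕ × ℕ)} (hs : IsRibbon s) {i j : ℕ} (hx : (i, j) ∈ s)
    {t : ℕ × ℕ} (ht : IsTail s t) (hne : (i, j) ≠ t) :
    (∃ i', i' + 1 = i ∧ (i', j) ∈ s) ∨ (i, j + 1) ∈ s := by
  have h1 := ht.2 _ hx
  have hlt : (j : ℤ) - i < (t.2 : ℤ) - t.1 := by
    by_contra hle
    dsimp only at h1
    exact hne (Prod.ext (by dsimp only; omega) (by dsimp only; omega))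
  obtain ⟨i', j', ⟨h1, h2, h3⟩ | ⟨h1, h2, h3⟩⟩ := hs.connected.exists_step hx ht.1 le_rfl hlt
  · have h4 := hs.eq_of_diagonal h1 hx (by push_cast; exact h3)
    rw [Prod.mk.injEq] at h4
    exact Or.inl ⟨i', h4.1, h4.2 ▸ h2⟩
  · have h4 := hs.eq_of_diagonal h1 hx h3
    rw [Prod.mk.injEq] at h4
    rw [h4.1, h4.2] at h2
    exact Or.inr h2

theorem below_or_left {s : Finset (ℕ × ℕ)} (hs : IsRibbon s) {i j : ℕ} (hx : (i, j) ∈ s)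
    {t : ℕ × ℕ} (ht : IsHead s t) (hne : (i, j) ≠ t) :
    (i + 1, j) ∈ s ∨ ∃ j', j' + 1 = j ∧ (i, j') ∈ s := by
  have h1 := ht.2 _ hx
  have hlt : (t.2 : ℤ) - t.1 ≤ (j : ℤ) - i - 1 := by
    by_contra hle
    dsimp only at h1
    exact hne (Prod.ext (by dsimp only; omega) (by dsimp only; omega))
  obtain ⟨i', j', ⟨h1, h2, h3⟩ | ⟨h1, h2, h3⟩⟩ :=
    hs.connected.exists_step ht.1 hx hlt (by dsimp only; omega)
  · have h4 := hs.eq_of_diagonal h2 hx (by dsimp only; omega)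
    rw [Prod.mk.injEq] at h4
    rw [h4.1, h4.2] at h1
    exact Or.inl h1
  · have h4 := hs.eq_of_diagonal h2 hx (by push_cast; omega)
    rw [Prod.mk.injEq] at h4
    exact Or.inr ⟨j', h4.2, h4.1 ▸ h1⟩

end IsRibbon

namespace OuterRibbonDecomposition

variable {S : RShape} {k : ℕ}

theorem content_eq_iff (S : RShape) (x w : ℕ × ℕ) :
    S.content x = S.content w ↔ (x.2 : ℤ) - x.1 = (w.2 : ℤ) - w.1 := by
  simp only [RShape.content]; omega

theorem ribbon_eq (D : OuterRibbonDecomposition S k) {x : ℕ × ℕ} {r r' : Fin k}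
    (h : x ∈ D.ribbon r) (h' : x ∈ D.ribbon r') : r = r' := by
  by_contra hne
  exact Finset.disjoint_left.mp (D.disjoint r r' hne) h h'

theorem mem_cells (D : OuterRibbonDecomposition S k) {x : ℕ × ℕ} {r : Fin k}
    (h : x ∈ D.ribbon r) : x ∈ S.cells := (D.mem_cells_iff x).mpr ⟨r, h⟩

theorem eq_of_content (D : OuterRibbonDecomposition S k) {x w : ℕ × ℕ} {r : Fin k}
    (hx : x ∈ D.ribbon r) (hw : w ∈ D.ribbon r) (h : S.content x = S.content w) : x = w :=
  (D.isRibbon r).eq_of_diagonal hx hw ((content_eq_iff S x w).mp h)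

/-- The cell u = (i, j + 1) has neighbours in the shape both below and to the left, so it is not a
head, and exactly one of them precedes it in its ribbon. If it is the one below, then (i + 1, j + 1)
goes up, while (i, j) cannot go right, so it goes up too. If it is the one on the left, neither goes
up. -/
theorem goesUp_diagonal (D : OuterRibbonDecomposition S k) {i j : ℕ} (hx : (i, j) ∈ S.cells)
    (hw : (i + 1, j + 1) ∈ S.cells) : D.GoesUp (i, j) ↔ D.GoesUp (i + 1, j + 1) := by
  have hu : (i, j + 1) ∈ S.cells :=
    RShape.mem_cells_of_between hx hw le_rfl (by omega) (by omega) le_rfl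
  obtain ⟨r, hr⟩ := (D.mem_cells_iff _).mp hu
  have hne : (i, j + 1) ≠ D.head r := by
    intro h
    rcases D.head_perimeter r with h' | h'
    · rw [← h] at h'
      exact h'.2 ⟨j, rfl, hx⟩
    · rw [← h] at h'
      exact h'.2 hw
  rcases (D.isRibbon r).below_or_left hr (D.isHead r) hne with h | ⟨j', hj', h⟩
  · refine iff_of_true ?_ ⟨r, h, Or.inl ⟨i, rfl, hr⟩⟩
    obtain ⟨r', hr'⟩ := (D.mem_cells_iff _).mp hx
    have hur' : (i, j + 1) ∉ D.ribbon r' := by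
      intro h'
      have h1 := D.ribbon_eq hr h'
      subst h1
      have := D.eq_of_content hr' h (by rw [content_eq_iff]; push_cast; ring)
      simp at this
    by_cases ht : (i, j) = D.tail r'
    · refine ⟨r', hr', Or.inr ⟨ht, ?_⟩⟩
      rcases D.tail_perimeter r' with h' | h'
      · rwa [ht]
      · rw [← ht] at h'
        exact absurd hu h'.2
    · rcases (D.isRibbon r').up_or_right hr' (D.isTail r') ht with h' | h'
      · exact ⟨r', hr', Or.inl h'⟩
      · exact absurd h' hur'
  · obtain rfl : j' = j := by omega
    refine iff_of_false ?_ ?_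
    · rintro ⟨r', hr', ⟨u, hu1, hu2⟩ | ⟨ht, -⟩⟩
      · have h1 := D.ribbon_eq h hr'
        subst h1
        have h2 := D.eq_of_content hu2 hr
          (by rw [content_eq_iff]; dsimp only at hu1 ⊢; push_cast [← hu1]; ring)
        rw [Prod.mk.injEq] at h2
        dsimp only at h2
        omega
      · have h1 := D.ribbon_eq h hr'
        subst h1
        have h2 := ((D.isTail r).2 _ hr).2
        rw [← ht] at h2
        dsimp only at h2
        omega
    · rintro ⟨r', hr', ⟨u, hu1, hu2⟩ | ⟨-, ht⟩⟩
      · obtain rfl : u = i := by dsimp only at hu1; omega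
        have h1 := D.ribbon_eq hr hu2
        subst h1
        have := D.eq_of_content h hr' (by rw [content_eq_iff]; push_cast; ring)
        simp at this
      · exact ht.2 ⟨i, rfl, hu⟩

theorem stripGoesUp_iff (D : OuterRibbonDecomposition S k) {x : ℕ × ℕ} (hx : x ∈ S.cells) :
    D.StripGoesUp (S.content x) ↔ D.GoesUp x := by
  refine ⟨?_, fun h => ⟨x, hx, rfl, h⟩⟩
  rintro ⟨w, hw, hwc, h⟩
  obtain ⟨i, j, N, hij, hdiag, hdiag'⟩ := RShape.exists_diagonal hx
  have key : ∀ m ≤ N, (D.GoesUp (i + m, j + m) ↔ D.GoesUp (i, j)) := by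
    intro m
    induction m with
    | zero => intro _; rfl
    | succ m ih =>
      intro hm
      rw [← ih (by omega)]
      exact (D.goesUp_diagonal (hdiag m (by omega)) (hdiag (m + 1) hm)).symm
  obtain ⟨m, hm, rfl⟩ := hdiag' x hx rfl
  obtain ⟨m', hm', rfl⟩ := hdiag' w hw hwc
  rw [key m hm]
  rwa [key m' hm'] at h

open Classical in
/-- The contents that the cutting strip enters by a step to the right. -/
noncomputable def rightContents (D : OuterRibbonDecomposition S k) : List ℤ :=
  ((S.cells.image S.content).filter fun c => ¬ D.StripGoesUp (c - 1)).sort (· ≤ ·)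

/-- The least content of the shape always qualifies, as no cell has content one less. This does no
harm: its cells have no left neighbour in the shape, and the pivot affects only entries from a
smaller content. -/
theorem mem_rightContents (D : OuterRibbonDecomposition S k) {c : ℤ} :
    c ∈ D.rightContents ↔ (∃ x ∈ S.cells, S.content x = c) ∧ ¬ D.StripGoesUp (c - 1) := by
  simp [rightContents]

theorem pairwise_rightContents (D : OuterRibbonDecomposition S k) :
    D.rightContents.Pairwise (· < ·) := Finset.sortedLT_sort _ |>.pairwise

/-- The predecessor relation of the cells given by `rightContents` is that of the ribbons. -/
theorem isPred_iff (D : OuterRibbonDecomposition S k) {x y : S.cells} {r : Fin k}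
    (hy : (y : ℕ × ℕ) ∈ D.ribbon r) :
    S.IsPred D.rightContents y x ↔
      (x : ℕ × ℕ) ∈ D.ribbon r ∧ S.content y + 1 = S.content x := by
  obtain ⟨⟨i, j⟩, hx⟩ := x
  obtain ⟨⟨i', j'⟩, hyS⟩ := y
  dsimp only at hy ⊢
  have hmem : S.content (i, j) ∈ D.rightContents ↔ ¬ D.StripGoesUp (S.content (i, j) - 1) := by
    rw [mem_rightContents, and_iff_right ⟨_, hx, rfl⟩]
  constructor
  · intro h
    have hc : S.content (i', j') + 1 = S.content (i, j) := h.content_eq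
    refine ⟨?_, hc⟩
    rw [← hc, add_sub_cancel_right, D.stripGoesUp_iff hyS, hc] at hmem
    by_cases hL : S.content (i, j) ∈ D.rightContents
    · have h' := (RShape.isPred_of_mem hL).mp h
      have hup := hmem.mp hL
      obtain ⟨h1, h2⟩ : i' = i ∧ j' + 1 = j := h'
      subst h1 h2
      by_cases ht : (i', j') = D.tail r
      · exfalso
        rcases D.tail_perimeter r with h3 | h3
        · rw [← ht] at h3
          exact hup ⟨r, hy, Or.inr ⟨ht, h3⟩⟩
        · rw [← ht] at h3
          exact h3.2 hx
      · rcases (D.isRibbon r).up_or_right hy (D.isTail r) ht with h3 | h3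
        · exact absurd ⟨r, hy, Or.inl h3⟩ hup
        · exact h3
    · have h' := (RShape.isPred_of_notMem hL).mp h
      have hup : D.GoesUp (i', j') := by
        by_contra hcon; exact hL (hmem.mpr hcon)
      obtain ⟨h1, h2⟩ : i' = i + 1 ∧ j' = j := h'
      subst h1 h2
      obtain ⟨r', hr', ⟨u, hu1, hu2⟩ | ⟨-, ht⟩⟩ := hup
      · obtain rfl : u = i := by dsimp only at hu1; omega
        rw [D.ribbon_eq hy hr']
        exact hu2
      · exact absurd ⟨i, rfl, hx⟩ ht.2
  · rintro ⟨hxr, hc⟩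
    rw [← hc, add_sub_cancel_right, D.stripGoesUp_iff hyS, hc] at hmem
    have hne : (i, j) ≠ D.head r := by
      intro h
      have h1 := (D.isHead r).2 _ hy
      rw [← h] at h1
      simp only [RShape.content] at hc h1
      omega
    rcases (D.isRibbon r).below_or_left hxr (D.isHead r) hne with h | ⟨j₁, hj₁, h⟩
    · have h1 := D.eq_of_content h hy (by
        have : S.content (i + 1, j) + 1 = S.content (i, j) := by
          simp only [RShape.content]; push_cast; ring
        omega)
      rw [Prod.mk.injEq] at h1
      obtain ⟨rfl, rfl⟩ := h1
      have hL : S.content (i, j) ∉ D.rightContents := by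
        rw [hmem, not_not]
        exact ⟨r, hy, Or.inl ⟨i, rfl, hxr⟩⟩
      exact (RShape.isPred_of_notMem hL).mpr ⟨rfl, rfl⟩
    · subst hj₁
      have h1 := D.eq_of_content h hy (by
        have : S.content (i, j₁) + 1 = S.content (i, j₁ + 1) := by
          simp only [RShape.content]; push_cast; ring
        omega)
      rw [Prod.mk.injEq] at h1
      obtain ⟨rfl, rfl⟩ := h1
      have hL : S.content (i, j₁ + 1) ∈ D.rightContents := by
        rw [hmem]
        rintro ⟨r', hr', ⟨u, hu1, hu2⟩ | ⟨ht, -⟩⟩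
        · have h1 := D.ribbon_eq hy hr'
          subst h1
          have h2 := D.eq_of_content hu2 hxr
            (by rw [content_eq_iff]; dsimp only at hu1 ⊢; push_cast [← hu1]; ring)
          rw [Prod.mk.injEq] at h2
          dsimp only at h2
          omega
        · have h1 := D.ribbon_eq hy hr'
          subst h1
          have h2 := ((D.isTail r).2 _ hxr).2
          rw [← ht] at h2
          dsimp only at h2
          omega
      exact (RShape.isPred_of_mem hL).mpr ⟨rfl, rfl⟩

/-- By `isPred_iff` the chains of the predecessor relation are the ribbons, so `det_chainMatrix`
applies with their heads and tails. -/
theorem det_cellMatrix_rightContents {R : Type*} [CommRing R] (D : OuterRibbonDecomposition S k)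
    (U : ℤ → ℤ → R) :
    (S.cellMatrix U D.rightContents).det = Matrix.det (Matrix.of fun i j : Fin k =>
      pivots U D.rightContents (S.content (D.head i)) (S.content (D.tail j) + 1)) := by
  choose rib hrib using fun x : S.cells => (D.mem_cells_iff x).mp x.2
  have hrib' : ∀ (x : S.cells) r, (x : ℕ × ℕ) ∈ D.ribbon r → rib x = r := fun x r h =>
    D.ribbon_eq (hrib x) h
  have hpred : ∀ x y : S.cells, S.IsPred D.rightContents y x ↔
      rib x = rib y ∧ S.content y + 1 = S.content x := by
    intro x y
    rw [D.isPred_iff (hrib y)]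
    exact and_congr_left' ⟨hrib' x _, fun h => h ▸ hrib x⟩
  have huniq : ∀ x y : S.cells, rib x = rib y → S.content x = S.content y → x = y :=
    fun x y h h' => Subtype.ext (D.eq_of_content (hrib x) (h ▸ hrib y) h')
  let head : Fin k → S.cells := fun i => ⟨D.head i, D.mem_cells (D.isHead i).1⟩
  let tail : Fin k → S.cells := fun i => ⟨D.tail i, D.mem_cells (D.isTail i).1⟩
  have hhead : ∀ i, rib (head i) = i := fun i => hrib' _ _ (D.isHead i).1
  have htail : ∀ i, rib (tail i) = i := fun i => hrib' _ _ (D.isTail i).1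
  refine det_chainMatrix (S.IsPred D.rightContents)
    (fun x y => pivots U D.rightContents (S.content x) (S.content y + 1))
    (fun x => S.content x) rib head tail ?_ ?_ ?_ ?_ ?_ hhead ?_ htail
  · intro x y h
    have := h.content_eq
    omega
  · intro x y y' h h'
    rw [hpred] at h h'
    exact huniq _ _ (h.1.symm.trans h'.1) (by omega)
  · intro x x' y h h'
    rw [hpred] at h h'
    exact huniq _ _ (h.1.trans h'.1.symm) (by omega)
  · intro x y h
    exact ((hpred x y).mp h).1.symm
  · intro x
    constructor
    · intro h
      by_contra hne
      have hne' : ((x : ℕ × ℕ).1, (x : ℕ × ℕ).2) ≠ D.head (rib x) := fun h' =>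
        hne (Subtype.ext h')
      have hx : ((x : ℕ × ℕ).1, (x : ℕ × ℕ).2) ∈ D.ribbon (rib x) := hrib x
      rcases (D.isRibbon _).below_or_left hx (D.isHead _) hne' with h' | ⟨j, hj, h'⟩
      · refine h ⟨⟨_, D.mem_cells h'⟩, (hpred _ _).mpr ⟨(hrib' _ _ h').symm, ?_⟩⟩
        simp only [RShape.content]; push_cast; ring
      · refine h ⟨⟨_, D.mem_cells h'⟩, (hpred _ _).mpr ⟨(hrib' _ _ h').symm, ?_⟩⟩
        simp only [RShape.content, ← hj]; push_cast; ring
    · rintro h ⟨y, hy⟩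
      rw [hpred] at hy
      have h1 := (D.isHead (rib x)).2 y (by rw [hy.1]; exact hrib y)
      have h2 : (x : ℕ × ℕ) = D.head (rib x) := congrArg Subtype.val h
      rw [← h2] at h1
      have h3 := hy.2
      simp only [RShape.content] at h3
      omega
  · intro y
    constructor
    · intro h
      by_contra hne
      have hne' : ((y : ℕ × ℕ).1, (y : ℕ × ℕ).2) ≠ D.tail (rib y) := fun h' =>
        hne (Subtype.ext h')
      have hy : ((y : ℕ × ℕ).1, (y : ℕ × ℕ).2) ∈ D.ribbon (rib y) := hrib y
      rcases (D.isRibbon _).up_or_right hy (D.isTail _) hne' with ⟨i, hi, h'⟩ | h'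
      · refine h ⟨⟨_, D.mem_cells h'⟩, (hpred _ _).mpr ⟨hrib' _ _ h', ?_⟩⟩
        simp only [RShape.content, ← hi]; push_cast; ring
      · refine h ⟨⟨_, D.mem_cells h'⟩, (hpred _ _).mpr ⟨hrib' _ _ h', ?_⟩⟩
        simp only [RShape.content]; push_cast; ring
    · rintro h ⟨x, hx⟩
      rw [hpred] at hx
      have h1 := (D.isTail (rib y)).2 x (by rw [← hx.1]; exact hrib x)
      have h2 : (y : ℕ × ℕ) = D.tail (rib y) := congrArg Subtype.val h
      rw [← h2] at h1
      have h3 := hx.2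
      simp only [RShape.content] at h3
      omega

end OuterRibbonDecomposition

section SortedLists

/-- In an increasing list the entries ≤ c form an initial segment. -/
theorem lt_length_filter_le_iff {l : List ℤ} (hl : l.Pairwise (· < ·)) {j : ℕ}
    (hj : j < l.length) (c : ℤ) :
    j < (l.filter fun x => x ≤ c).length ↔ l.getD j 0 ≤ c := by
  induction l generalizing j with
  | nil => simp at hj
  | cons x l ih =>
    rw [List.pairwise_cons] at hl
    by_cases hx : x ≤ c
    · rw [List.filter_cons_of_pos (by simpa using hx)]
      cases j with
      | zero => simpa using hx
      | succ j =>
        rw [List.length_cons, Nat.add_lt_add_iff_right, ih hl.2 (by simpa using hj)]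
        simp
    · rw [List.filter_cons_of_neg (by simpa using hx)]
      have h1 : l.filter (fun x => x ≤ c) = [] := by
        rw [List.filter_eq_nil_iff]
        intro y hy
        have := hl.1 y hy
        simp only [decide_eq_true_eq]; omega
      rw [h1]
      refine iff_of_false (by simp) ?_
      cases j with
      | zero => simpa using hx
      | succ j =>
        rw [List.getD_cons_succ, List.getD_eq_getElem _ _ (by simpa using hj)]
        have := hl.1 _ (List.getElem_mem (by simpa using hj : j < l.length))
        omega

end SortedLists

/-! ### Shapes from sets of cells; variation of the flags along the contents -/

namespace RShape

theorem mem_ofCells_outer {X : Finset (ℕ × ℕ)} {r : ℤ} {x : ℕ × ℕ} :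
    x ∈ (ofCells X r).outer ↔ ∃ s ∈ X, x ≤ s := by
  rw [← YoungDiagram.mem_cells]
  simp [ofCells]

theorem mem_ofCells_inner {X : Finset (ℕ × ℕ)} {r : ℤ} {x : ℕ × ℕ} :
    x ∈ (ofCells X r).inner ↔ (∃ s ∈ X, x ≤ s) ∧ ∀ s ∈ X, ¬ s ≤ x := by
  rw [← YoungDiagram.mem_cells]
  simp [ofCells]

theorem colLen_eq_of_forall {μ : YoungDiagram} {j m : ℕ} (h : ∀ i, (i, j) ∈ μ ↔ i < m) :
    μ.colLen j = m := by
  refine le_antisymm ?_ ?_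
  · by_contra! hlt
    exact lt_irrefl _ ((h m).mp (YoungDiagram.mem_iff_lt_colLen.mpr hlt))
  · by_contra! hlt
    exact lt_irrefl _ (YoungDiagram.mem_iff_lt_colLen.mp ((h _).mpr hlt))

theorem rowLen_eq_of_forall {μ : YoungDiagram} {i m : ℕ} (h : ∀ j, (i, j) ∈ μ ↔ j < m) :
    μ.rowLen i = m := by
  refine le_antisymm ?_ ?_
  · by_contra! hlt
    exact lt_irrefl _ ((h m).mp (YoungDiagram.mem_iff_lt_rowLen.mpr hlt))
  · by_contra! hlt
    exact lt_irrefl _ (YoungDiagram.mem_iff_lt_rowLen.mp ((h _).mpr hlt))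

/-- The contents of a connected shape form an interval. -/
theorem exists_content_eq {S : RShape} (hS : CellsConnected S.cells) {p q c : ℤ}
    (hp : ∃ x ∈ S.cells, S.content x = p) (hq : ∃ x ∈ S.cells, S.content x = q)
    (hpc : p ≤ c) (hcq : c ≤ q) : ∃ x ∈ S.cells, S.content x = c := by
  rcases hcq.eq_or_lt with rfl | hlt
  · exact hq
  obtain ⟨x, hx, rfl⟩ := hp
  obtain ⟨z, hz, rfl⟩ := hq
  simp only [content] at hpc hlt
  obtain ⟨i, j, ⟨h1, h2, h3⟩ | ⟨h1, h2, h3⟩⟩ :=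
    hS.exists_step hx hz (c := c - (S.root - 1 + S.outer.colLen 0)) (by omega) (by omega)
  · exact ⟨_, h1, by simp only [content]; push_cast; omega⟩
  · exact ⟨_, h1, by simp only [content]; omega⟩

/-- The first cell of the next diagonal has a neighbour below or on the left, on the current
diagonal, so its column is no smaller. The first cell of the current diagonal has a neighbour above
or on the right, so the column grows by at most one. -/
theorem leftmost_succ {S : RShape} (hS : CellsConnected S.cells) {x z : ℕ × ℕ} (hx : x ∈ S.cells)
    (hz : z ∈ S.cells) (h : S.content z = S.content x + 1) :
    (S.leftmost (S.content z)).2 = (S.leftmost (S.content x)).2 ∨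
      S.leftmost (S.content z) =
        ((S.leftmost (S.content x)).1, (S.leftmost (S.content x)).2 + 1) := by
  obtain ⟨x1, x2, x3⟩ := leftmost_spec hx
  obtain ⟨z1, z2, z3⟩ := leftmost_spec hz
  generalize S.leftmost (S.content x) = v at x1 x2 x3 ⊢
  generalize S.leftmost (S.content z) = w at z1 z2 z3 ⊢
  obtain ⟨i, j⟩ := v
  obtain ⟨i', j'⟩ := w
  have e1 : j ≤ j' := by
    rcases below_or_left hS z1 hx (by omega) with h' | ⟨t, ht, h'⟩
    · exact (x3 _ h' (by rw [← add_left_inj 1, ← h, ← z2]; simp only [content]; push_cast; ring)).2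
    · have := (x3 _ h' (by
        rw [← add_left_inj 1, ← h, ← z2]; simp only [content]; push_cast [← ht]; ring)).2
      dsimp only at this; omega
  have e2 : j' ≤ j + 1 := by
    rcases up_or_right hS x1 hz (by omega) with ⟨t, ht, h'⟩ | h'
    · have := (z3 _ h' (by rw [h, ← x2]; simp only [content]; push_cast [← ht]; ring)).2
      dsimp only at this; omega
    · exact (z3 _ h' (by rw [h, ← x2]; simp only [content]; push_cast; ring)).2
  simp only [content] at z2 x2 h
  rcases e1.eq_or_lt with h' | h'
  · exact Or.inl h'.symm
  · exact Or.inr (Prod.ext (by dsimp only; omega) (by dsimp only; omega))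

theorem rightmost_succ {S : RShape} (hS : CellsConnected S.cells) {x z : ℕ × ℕ}
    (hx : x ∈ S.cells) (hz : z ∈ S.cells) (h : S.content z = S.content x + 1) :
    ((S.rightmost (S.content x)).1 = (S.rightmost (S.content z)).1 + 1 ∧
      (S.rightmost (S.content z)).2 = (S.rightmost (S.content x)).2) ∨
      S.rightmost (S.content z) =
        ((S.rightmost (S.content x)).1, (S.rightmost (S.content x)).2 + 1) := by
  obtain ⟨x1, x2, x3⟩ := rightmost_spec hx
  obtain ⟨z1, z2, z3⟩ := rightmost_spec hz
  generalize S.rightmost (S.content x) = v at x1 x2 x3 ⊢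
  generalize S.rightmost (S.content z) = w at z1 z2 z3 ⊢
  obtain ⟨i, j⟩ := v
  obtain ⟨i', j'⟩ := w
  have e1 : j' ≤ j + 1 := by
    rcases below_or_left hS z1 hx (by omega) with h' | ⟨t, ht, h'⟩
    · have := (x3 _ h' (by
        rw [← add_left_inj 1, ← h, ← z2]; simp only [content]; push_cast; ring)).2
      dsimp only at this; omega
    · have := (x3 _ h' (by
        rw [← add_left_inj 1, ← h, ← z2]; simp only [content]; push_cast [← ht]; ring)).2
      dsimp only at this; omega
  have e2 : j ≤ j' := by
    rcases up_or_right hS x1 hz (by omega) with ⟨t, ht, h'⟩ | h'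
    · exact (z3 _ h' (by rw [h, ← x2]; simp only [content]; push_cast [← ht]; ring)).2
    · have := (z3 _ h' (by rw [h, ← x2]; simp only [content]; push_cast; ring)).2
      dsimp only at this; omega
  simp only [content] at z2 x2 h
  rcases e2.eq_or_lt with h' | h'
  · exact Or.inl ⟨by dsimp only; omega, h'.symm⟩
  · exact Or.inr (Prod.ext (by dsimp only; omega) (by dsimp only; omega))

theorem sub_le_of_succ {S : RShape} (hS : CellsConnected S.cells) {f : ℤ → ℤ}
    (hf : ∀ x ∈ S.cells, ∀ z ∈ S.cells, S.content z = S.content x + 1 →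
      f (S.content x) - f (S.content z) ≤ 1) {c d : ℤ}
    (hc : ∃ x ∈ S.cells, S.content x = c) (hd : ∃ x ∈ S.cells, S.content x = d) (hcd : c ≤ d) :
    f c - f d ≤ d - c := by
  induction d, hcd using Int.leInduction with
  | base => simp
  | succ d hcd ih =>
    have hd' := exists_content_eq hS hc hd hcd (by omega)
    have h1 := ih hd'
    obtain ⟨x, hx, hxd⟩ := hd'
    obtain ⟨z, hz, hzd⟩ := hd
    have h2 := hf x hx z hz (by omega)
    rw [hxd, hzd] at h2
    omega

/-- Along increasing contents, the lower flag drops by at most the difference of the contents. -/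
theorem lowerAt_sub_le {S : RShape} (hS : CellsConnected S.cells) {a b : ℕ → ℤ}
    (hab : S.IsStrictFlags a b) {c d : ℤ} (hc : ∃ x ∈ S.cells, S.content x = c)
    (hd : ∃ x ∈ S.cells, S.content x = d) (hcd : c ≤ d) :
    S.lowerAt a c - S.lowerAt a d ≤ d - c := by
  refine sub_le_of_succ hS (fun x hx z hz h => ?_) hc hd hcd
  simp only [lowerAt]
  obtain ⟨x1, -, -⟩ := leftmost_spec hx
  obtain ⟨z1, -, -⟩ := leftmost_spec hz
  rcases leftmost_succ hS hx hz h with h' | h'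
  · rw [h']; simp
  · rw [h'] at z1 ⊢
    generalize S.leftmost (S.content x) = v at x1 z1 ⊢
    obtain ⟨i, j⟩ := v
    -- Two cells side by side in one row show that the columns overlap, which is where strictness
    -- bounds the drop by 1.
    refine hab.2 _ ?_
    have h1 := (mem_cells.mp x1).2
    have h2 := (mem_cells.mp z1).1
    exact h1.trans_lt h2

/-- Along increasing contents, the upper flag drops by at most the difference of the contents. -/
theorem upperAt_sub_le {S : RShape} (hS : CellsConnected S.cells) {a b : ℕ → ℤ}
    (hab : S.IsFlags a b) {c d : ℤ} (hc : ∃ x ∈ S.cells, S.content x = c)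
    (hd : ∃ x ∈ S.cells, S.content x = d) (hcd : c ≤ d) :
    S.upperAt b c - S.upperAt b d ≤ d - c := by
  refine sub_le_of_succ hS (fun x hx z hz h => ?_) hc hd hcd
  simp only [upperAt]
  obtain ⟨x1, -, -⟩ := rightmost_spec hx
  obtain ⟨z1, -, -⟩ := rightmost_spec hz
  rcases rightmost_succ hS hx hz h with ⟨h1, h2⟩ | h'
  -- An upward step keeps the column, so only the row term changes, by exactly 1.
  · rw [h2, h1]; push_cast; omega
  · rw [h'] at z1 ⊢
    generalize S.rightmost (S.content x) = v at x1 z1 ⊢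
    obtain ⟨i, j⟩ := v
    have h1 := (mem_cells.mp x1).2
    have h2 := (mem_cells.mp z1).1
    have h3 := (hab _ (h1.trans_lt h2)).2
    dsimp only
    omega

end RShape

/-! ### Sub-ribbons of the cutting strip -/

namespace OuterRibbonDecomposition

variable {S : RShape} {k : ℕ}

section Strip

open Classical in
/-- The number of upward steps of the strip from content `c` to content `q`. -/
noncomputable def upSteps (D : OuterRibbonDecomposition S k) (c q : ℤ) : ℕ :=
  ((Finset.Ico c q).filter fun d => D.StripGoesUp d).card

open Classical in
/-- The number of steps to the right of the strip from content `p` to content `c`. -/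
noncomputable def rightSteps (D : OuterRibbonDecomposition S k) (p c : ℤ) : ℕ :=
  ((Finset.Ico p c).filter fun d => ¬ D.StripGoesUp d).card

theorem mem_stripCells (D : OuterRibbonDecomposition S k) {p q : ℤ} {x : ℕ × ℕ} :
    x ∈ D.stripCells p q ↔ ∃ c, (p ≤ c ∧ c ≤ q) ∧ (D.upSteps c q, D.rightSteps p c) = x := by
  simp [stripCells, upSteps, rightSteps]

theorem upSteps_anti (D : OuterRibbonDecomposition S k) {c d : ℤ} (q : ℤ) (h : c ≤ d) :
    D.upSteps d q ≤ D.upSteps c q := by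
  classical
  exact Finset.card_le_card (Finset.filter_subset_filter _ (Finset.Ico_subset_Ico_left h))

theorem upSteps_add_rightSteps (D : OuterRibbonDecomposition S k) {p c q : ℤ} (hp : p ≤ c)
    (hq : c ≤ q) : (D.upSteps p q : ℤ) - D.upSteps c q + D.rightSteps p c = c - p := by
  classical
  have h1 : D.upSteps p q = ((Finset.Ico p c).filter fun d => D.StripGoesUp d).card +
      D.upSteps c q := by
    rw [upSteps, ← Finset.Ico_union_Ico_eq_Ico hp hq, Finset.filter_union,
      Finset.card_union_of_disjoint]
    · rfl
    · exact Finset.disjoint_filter_filter (Finset.Ico_disjoint_Ico_consecutive p c q)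
  have h2 := Finset.card_filter_add_card_filter_not (s := Finset.Ico p c)
    (fun d => D.StripGoesUp d)
  rw [Int.card_Ico] at h2
  have h3 : D.rightSteps p c = ((Finset.Ico p c).filter fun d => ¬ D.StripGoesUp d).card := rfl
  omega

/-- `l` is the list of the contents in `(p, q]` that the strip enters by a step to the right. -/
structure IsRightList (D : OuterRibbonDecomposition S k) (p q : ℤ) (l : List ℤ) : Prop where
  sorted : l.Pairwise (· < ·)
  mem_iff : ∀ x, x ∈ l ↔ (p < x ∧ x ≤ q) ∧ ¬ D.StripGoesUp (x - 1)

variable {D : OuterRibbonDecomposition S k} {p q : ℤ} {l : List ℤ}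

theorem IsRightList.rightSteps_eq (hl : D.IsRightList p q l) {c : ℤ} (hc : c ≤ q) :
    D.rightSteps p c = (l.filter fun x => x ≤ c).length := by
  classical
  have hnd : (l.filter fun x => x ≤ c).Nodup :=
    (hl.sorted.imp fun h => ne_of_lt h).filter _
  rw [← List.toFinset_card_of_nodup hnd, rightSteps]
  refine Finset.card_bij (fun d _ => d + 1) ?_ ?_ ?_
  · intro d hd
    simp only [Finset.mem_filter, Finset.mem_Ico] at hd
    simp only [List.mem_toFinset, List.mem_filter, hl.mem_iff, decide_eq_true_eq,
      add_sub_cancel_right]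
    exact ⟨⟨⟨by omega, by omega⟩, hd.2⟩, by omega⟩
  · intro d _ d' _ h
    exact add_right_cancel h
  · intro x hx
    simp only [List.mem_toFinset, List.mem_filter, hl.mem_iff, decide_eq_true_eq] at hx
    refine ⟨x - 1, ?_, by ring⟩
    simp only [Finset.mem_filter, Finset.mem_Ico]
    exact ⟨⟨by omega, by omega⟩, hx.1.2⟩

/-- The list `p :: l` gives the contents of the bottom cells of the columns, and `l ++ [q + 1]`
those of the top cells plus one. Thus column r consists of the contents from the r-th entry of the
first list up to, but excluding, the r-th entry of the second. -/
theorem IsRightList.le_rightSteps_iff (hl : D.IsRightList p q l) {c : ℤ} (hp : p ≤ c)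
    (hc : c ≤ q) {r : ℕ} (hr : r ≤ l.length) :
    r ≤ D.rightSteps p c ↔ (p :: l).getD r 0 ≤ c := by
  rw [hl.rightSteps_eq hc]
  cases r with
  | zero => simpa using hp
  | succ r =>
    rw [Nat.succ_le_iff, lt_length_filter_le_iff hl.sorted hr, List.getD_cons_succ]

theorem IsRightList.rightSteps_le_iff (hl : D.IsRightList p q l) {c : ℤ}
    (hc : c ≤ q) {r : ℕ} (hr : r ≤ l.length) :
    D.rightSteps p c ≤ r ↔ c < (l ++ [q + 1]).getD r 0 := by
  rw [hl.rightSteps_eq hc]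
  rcases hr.eq_or_lt with rfl | hr
  · refine iff_of_true (List.length_filter_le _ _) ?_
    rw [List.getD_append_right _ _ _ _ le_rfl]
    simp; omega
  · rw [← not_lt, lt_length_filter_le_iff hl.sorted hr, not_le, List.getD_append _ _ _ _ hr]

theorem IsRightList.rightSteps_le (hl : D.IsRightList p q l) {c : ℤ} (hc : c ≤ q) :
    D.rightSteps p c ≤ l.length := by
  rw [hl.rightSteps_eq hc]
  exact List.length_filter_le _ _

theorem IsRightList.bottom_mem (hl : D.IsRightList p q l) (hpq : p ≤ q) {r : ℕ}
    (hr : r ≤ l.length) : p ≤ (p :: l).getD r 0 ∧ (p :: l).getD r 0 ≤ q := by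
  cases r with
  | zero => simpa using hpq
  | succ r =>
    rw [List.getD_cons_succ, List.getD_eq_getElem _ _ hr]
    have := (hl.mem_iff _).mp (List.getElem_mem hr)
    exact ⟨this.1.1.le, this.1.2⟩

theorem IsRightList.bottom_lt (hl : D.IsRightList p q l) (hpq : p ≤ q) {r : ℕ}
    (hr : r ≤ l.length) : (p :: l).getD r 0 < (l ++ [q + 1]).getD r 0 := by
  obtain ⟨h1, h2⟩ := hl.bottom_mem hpq hr
  rcases hr.eq_or_lt with rfl | hr'
  · rw [List.getD_append_right _ _ _ _ le_rfl]
    simp only [Nat.sub_self, List.getD_cons_zero]; omega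
  · rw [List.getD_append _ _ _ _ hr', List.getD_eq_getElem _ _ hr']
    cases r with
    | zero =>
      rw [List.getD_cons_zero]
      exact ((hl.mem_iff _).mp (List.getElem_mem hr')).1.1
    | succ r =>
      rw [List.getD_cons_succ, List.getD_eq_getElem _ _ (by omega)]
      exact List.pairwise_iff_getElem.mp hl.sorted _ _ _ _ (Nat.lt_succ_self r)

theorem IsRightList.top_le (hl : D.IsRightList p q l) {r : ℕ}
    (hr : r ≤ l.length) : (l ++ [q + 1]).getD r 0 ≤ q + 1 := by
  rcases hr.eq_or_lt with rfl | hr'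
  · rw [List.getD_append_right _ _ _ _ le_rfl]
    simp
  · rw [List.getD_append _ _ _ _ hr', List.getD_eq_getElem _ _ hr']
    have := ((hl.mem_iff _).mp (List.getElem_mem hr')).1.2
    omega

theorem IsRightList.rightSteps_bottom (hl : D.IsRightList p q l) (hpq : p ≤ q) {r : ℕ}
    (hr : r ≤ l.length) : D.rightSteps p ((p :: l).getD r 0) = r := by
  obtain ⟨h1, h2⟩ := hl.bottom_mem hpq hr
  exact le_antisymm ((hl.rightSteps_le_iff h2 hr).mpr (hl.bottom_lt hpq hr))
    ((hl.le_rightSteps_iff h1 h2 hr).mpr le_rfl)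

theorem IsRightList.rightSteps_top (hl : D.IsRightList p q l) (hpq : p ≤ q) {r : ℕ}
    (hr : r ≤ l.length) : D.rightSteps p ((l ++ [q + 1]).getD r 0 - 1) = r := by
  have h1 := hl.bottom_mem hpq hr
  have h2 := hl.bottom_lt hpq hr
  have h3 := hl.top_le hr
  exact le_antisymm ((hl.rightSteps_le_iff (by omega) hr).mpr (by omega))
    ((hl.le_rightSteps_iff (by omega) (by omega) hr).mpr (by omega))

/-- The r-shape `Θ(p, q)`. -/
noncomputable def strip (D : OuterRibbonDecomposition S k) (p q : ℤ) : RShape :=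
  RShape.ofCells (D.stripCells p q) p

theorem mem_strip_outer {i j : ℕ} : (i, j) ∈ (D.strip p q).outer ↔
    ∃ c, (p ≤ c ∧ c ≤ q) ∧ i ≤ D.upSteps c q ∧ j ≤ D.rightSteps p c := by
  rw [strip, RShape.mem_ofCells_outer]
  constructor
  · rintro ⟨s, hs, h⟩
    obtain ⟨c, hc, rfl⟩ := D.mem_stripCells.mp hs
    exact ⟨c, hc, h.1, h.2⟩
  · rintro ⟨c, hc, h⟩
    exact ⟨_, D.mem_stripCells.mpr ⟨c, hc, rfl⟩, h.1, h.2⟩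

theorem strip_outer_colLen_of_lt (h : q < p) (j : ℕ) : (D.strip p q).outer.colLen j = 0 := by
  refine RShape.colLen_eq_of_forall fun i => ?_
  rw [mem_strip_outer]
  refine iff_of_false ?_ (Nat.not_lt_zero i)
  rintro ⟨c, hc, -⟩
  omega

theorem strip_width_of_lt (h : q < p) : (D.strip p q).width = 0 := by
  refine RShape.rowLen_eq_of_forall fun j => ?_
  rw [mem_strip_outer]
  refine iff_of_false ?_ (Nat.not_lt_zero j)
  rintro ⟨c, hc, -⟩
  omega

theorem IsRightList.strip_width (hl : D.IsRightList p q l) (hpq : p ≤ q) :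
    (D.strip p q).width = l.length + 1 := by
  refine RShape.rowLen_eq_of_forall fun j => ?_
  rw [mem_strip_outer, Nat.lt_succ_iff]
  constructor
  · rintro ⟨c, hc, -, h⟩
    exact h.trans (hl.rightSteps_le hc.2)
  · intro h
    exact ⟨_, hl.bottom_mem hpq h, Nat.zero_le _, (hl.rightSteps_bottom hpq h).ge⟩

theorem IsRightList.strip_outer_colLen (hl : D.IsRightList p q l) (hpq : p ≤ q) {r : ℕ}
    (hr : r ≤ l.length) :
    (D.strip p q).outer.colLen r = D.upSteps ((p :: l).getD r 0) q + 1 := by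
  refine RShape.colLen_eq_of_forall fun i => ?_
  rw [mem_strip_outer, Nat.lt_succ_iff]
  constructor
  · rintro ⟨c, hc, h1, h2⟩
    exact h1.trans (D.upSteps_anti q ((hl.le_rightSteps_iff hc.1 hc.2 hr).mp h2))
  · intro h
    exact ⟨_, hl.bottom_mem hpq hr, h, (hl.rightSteps_bottom hpq hr).ge⟩

theorem IsRightList.strip_outer_colLen_eq_zero (hl : D.IsRightList p q l) {r : ℕ}
    (hr : l.length < r) : (D.strip p q).outer.colLen r = 0 := by
  refine RShape.colLen_eq_of_forall fun i => ?_
  rw [mem_strip_outer]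
  refine iff_of_false ?_ (Nat.not_lt_zero i)
  rintro ⟨c, hc, -, h⟩
  have := hl.rightSteps_le hc.2
  omega

theorem IsRightList.strip_inner_colLen (hl : D.IsRightList p q l) (hpq : p ≤ q) {r : ℕ}
    (hr : r ≤ l.length) :
    (D.strip p q).inner.colLen r = D.upSteps ((l ++ [q + 1]).getD r 0 - 1) q := by
  have h1 := hl.bottom_mem hpq hr
  have h2 := hl.bottom_lt hpq hr
  have h3 := hl.top_le hr
  refine RShape.colLen_eq_of_forall fun i => ?_
  rw [strip, RShape.mem_ofCells_inner]
  constructor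
  · rintro ⟨-, h⟩
    by_contra hle
    refine h _ (D.mem_stripCells.mpr ⟨(l ++ [q + 1]).getD r 0 - 1, ⟨by omega, by omega⟩, rfl⟩)
      ⟨not_lt.mp hle, (hl.rightSteps_top hpq hr).le⟩
  · intro hi
    refine ⟨⟨_, D.mem_stripCells.mpr ⟨_, h1, rfl⟩, ?_, (hl.rightSteps_bottom hpq hr).ge⟩, ?_⟩
    · exact hi.le.trans (D.upSteps_anti q (by omega))
    · rintro s hs ⟨hs1, hs2⟩
      obtain ⟨c, hc, rfl⟩ := D.mem_stripCells.mp hs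
      have h4 := (hl.rightSteps_le_iff hc.2 hr).mp hs2
      have h5 := D.upSteps_anti q (show c ≤ (l ++ [q + 1]).getD r 0 - 1 by omega)
      dsimp only at hs1
      omega

/-- The first column has p as its bottom content, so the root is placed correctly; from there each
step of the strip, up or right, raises the content by one. -/
theorem IsRightList.strip_content (hl : D.IsRightList p q l) (hpq : p ≤ q) {c : ℤ} (hpc : p ≤ c)
    (hcq : c ≤ q) : (D.strip p q).content (D.upSteps c q, D.rightSteps p c) = c := by
  have h1 := hl.strip_outer_colLen hpq (Nat.zero_le _)
  have h2 := D.upSteps_add_rightSteps hpc hcq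
  have h3 : (D.strip p q).root = p := rfl
  simp only [RShape.content, h1, h3, List.getD_cons_zero]
  push_cast
  omega

theorem IsRightList.strip_content_bottomCell (hl : D.IsRightList p q l) (hpq : p ≤ q) {r : ℕ}
    (hr : r ≤ l.length) :
    (D.strip p q).content ((D.strip p q).bottomCell r) = (p :: l).getD r 0 := by
  obtain ⟨h1, h2⟩ := hl.bottom_mem hpq hr
  have h3 := hl.strip_content hpq h1 h2
  rw [hl.rightSteps_bottom hpq hr] at h3
  rw [RShape.bottomCell, hl.strip_outer_colLen hpq hr, Nat.add_sub_cancel]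
  exact h3

theorem IsRightList.strip_content_topCell (hl : D.IsRightList p q l) (hpq : p ≤ q) {r : ℕ}
    (hr : r ≤ l.length) :
    (D.strip p q).content ((D.strip p q).topCell r) = (l ++ [q + 1]).getD r 0 - 1 := by
  have h1 := hl.bottom_mem hpq hr
  have h2 := hl.bottom_lt hpq hr
  have h3 := hl.top_le hr
  have h4 := hl.strip_content hpq (c := (l ++ [q + 1]).getD r 0 - 1) (by omega) (by omega)
  rw [hl.rightSteps_top hpq hr] at h4
  rw [RShape.topCell, hl.strip_inner_colLen hpq hr]
  exact h4

/-- The flagged Schur function of a strip as the determinant of a strip matrix. -/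
theorem IsRightList.flaggedSchur_strip {R : Type*} [CommRing R] (hl : D.IsRightList p q l)
    (hpq : p ≤ q) (a b : ℕ → ℤ) (y z : ℤ → R) :
    (D.strip p q).flaggedSchur (D.strip p q).width
        (fun r => S.lowerAt a ((D.strip p q).content ((D.strip p q).topCell r)))
        (fun r => S.upperAt b ((D.strip p q).content ((D.strip p q).bottomCell r))) y z =
      (stripMatrix (S.columnEntry a b y z) p l (q + 1)).det := by
  rw [hl.strip_width hpq, RShape.flaggedSchur, stripMatrix]
  congr 1
  ext r s
  have hr : (r : ℕ) ≤ l.length := Nat.lt_succ_iff.mp r.2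
  have hs : (s : ℕ) ≤ l.length := Nat.lt_succ_iff.mp s.2
  have e1 := hl.strip_content_bottomCell hpq hr
  have e2 := hl.strip_content_topCell hpq hs
  have e3 := hl.strip_outer_colLen hpq hr
  have e1' := e1
  have e2' := e2
  simp only [RShape.content, RShape.topCell, RShape.bottomCell] at e1' e2'
  rw [of_apply, of_apply, RShape.columnEntry, RShape.conjLower, RShape.conjUpper, e1, e2]
  -- The degree of the entry is the top content of column s plus one minus the bottom content of
  -- column r.
  congr 1
  · omega
  · congr 1 <;> omega

/-- The flags induced on a strip are flags. -/
theorem IsRightList.isFlags_strip (hS : CellsConnected S.cells) (hl : D.IsRightList p q l)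
    (hpq : p ≤ q) (hp : ∃ x ∈ S.cells, S.content x = p) (hq : ∃ x ∈ S.cells, S.content x = q)
    {a b : ℕ → ℤ} (hab : S.IsStrictFlags a b) :
    (D.strip p q).IsFlags
      (fun r => S.lowerAt a ((D.strip p q).content ((D.strip p q).topCell r)))
      (fun r => S.upperAt b ((D.strip p q).content ((D.strip p q).bottomCell r))) := by
  intro r hr
  have hr1 : r + 1 ≤ l.length := by
    by_contra hlt
    rw [hl.strip_outer_colLen_eq_zero (by omega)] at hr
    exact Nat.not_lt_zero _ hr
  have hr0 : r ≤ l.length := by omega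
  -- The bottom content of a column is one more than the top content of the preceding column.
  have hmid : (p :: l).getD (r + 1) 0 = (l ++ [q + 1]).getD r 0 := by
    rw [List.getD_cons_succ, List.getD_append _ _ _ _ hr1]
  have e1 := hl.strip_content_bottomCell hpq hr0
  have e2 := hl.strip_content_bottomCell hpq hr1
  have e3 := hl.strip_content_topCell hpq hr0
  have e4 := hl.strip_content_topCell hpq hr1
  have b1 := hl.bottom_mem hpq hr0
  have b2 := hl.bottom_mem hpq hr1
  have b3 := hl.bottom_lt hpq hr0
  have b4 := hl.bottom_lt hpq hr1
  have b5 := hl.top_le hr1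
  have o1 := hl.strip_outer_colLen hpq hr0
  have o2 := hl.strip_outer_colLen hpq hr1
  have hex : ∀ c, p ≤ c → c ≤ q → ∃ x ∈ S.cells, S.content x = c := fun c h h' =>
    RShape.exists_content_eq hS hp hq h h'
  constructor
  -- The bound in the flag condition, μ'_r - μ'_{r+1} + 1, is the difference of the contents of the
  -- top cells; likewise for the bottom cells below.
  · have h := RShape.lowerAt_sub_le hS hab (hex ((l ++ [q + 1]).getD r 0 - 1) (by omega) (by omega))
      (hex ((l ++ [q + 1]).getD (r + 1) 0 - 1) (by omega) (by omega)) (by omega)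
    dsimp only
    rw [e3, e4]
    simp only [RShape.content, RShape.topCell] at e3 e4
    push_cast at e4
    omega
  · have h := RShape.upperAt_sub_le hS hab.1 (hex ((p :: l).getD r 0) b1.1 b1.2)
      (hex ((p :: l).getD (r + 1) 0) b2.1 b2.2) (by omega)
    dsimp only
    rw [e1, e2]
    simp only [RShape.content, RShape.bottomCell] at e1 e2
    push_cast at e2
    omega

end Strip

/-! ### Assembly -/

theorem isRightList_filter (D : OuterRibbonDecomposition S k) (hS : CellsConnected S.cells)
    {p q : ℤ} (hp : ∃ x ∈ S.cells, S.content x = p) (hq : ∃ x ∈ S.cells, S.content x = q) :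
    D.IsRightList p q (D.rightContents.filter fun x => p < x ∧ x < q + 1) where
  sorted := D.pairwise_rightContents.filter _
  mem_iff x := by
    rw [List.mem_filter, mem_rightContents, decide_eq_true_eq, Int.lt_add_one_iff]
    constructor
    · rintro ⟨h, h'⟩
      exact ⟨h', h.2⟩
    · rintro ⟨h, h'⟩
      exact ⟨⟨RShape.exists_content_eq hS hp hq h.1.le h.2, h'⟩, h⟩

theorem exists_content_head (D : OuterRibbonDecomposition S k) (i : Fin k) :
    ∃ x ∈ S.cells, S.content x = S.content (D.head i) :=
  ⟨_, D.mem_cells (D.isHead i).1, rfl⟩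

theorem exists_content_tail (D : OuterRibbonDecomposition S k) (i : Fin k) :
    ∃ x ∈ S.cells, S.content x = S.content (D.tail i) :=
  ⟨_, D.mem_cells (D.isTail i).1, rfl⟩

/-- The conventions for undefined and empty shapes are those of a unitriangular array: 0 below the
diagonal and 1 on it. Above the diagonal both sides are the same Hessenberg determinant. -/
theorem ribbonEntry_eq_pivots {R : Type*} [CommRing R] (D : OuterRibbonDecomposition S k)
    (hS : CellsConnected S.cells) (a b : ℕ → ℤ) (y z : ℤ → R) (i j : Fin k) :
    D.ribbonEntry a b y z i j = pivots (S.columnEntry a b y z) D.rightContents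
      (S.content (D.head i)) (S.content (D.tail j) + 1) := by
  have h1 := S.columnEntry_self a b y z
  have h0 := S.columnEntry_of_lt a b y z
  rw [ribbonEntry]
  split_ifs with h
  · rw [pivots_of_lt h0 _ h]
  rcases (not_lt.mp h).eq_or_lt with h' | h'
  · rw [← h', pivots_self h1]
    have hw : (D.hash i j).width = 0 :=
      strip_width_of_lt (D := D) (p := S.content (D.head i)) (q := S.content (D.tail j)) (by omega)
    rw [hw, RShape.flaggedSchur, det_isEmpty]
  · rw [pivots_eq_det_stripMatrix h1 h0 _ D.pairwise_rightContents]
    exact (D.isRightList_filter hS (D.exists_content_head i)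
      (D.exists_content_tail j)).flaggedSchur_strip (by omega) a b y z

theorem isFlags_hash (D : OuterRibbonDecomposition S k) (hS : CellsConnected S.cells)
    {a b : ℕ → ℤ} (hab : S.IsStrictFlags a b) (i j : Fin k) :
    (D.hash i j).IsFlags (D.inducedLower a i j) (D.inducedUpper b i j) := by
  rcases lt_or_ge (S.content (D.tail j)) (S.content (D.head i)) with h | h
  · intro r hr
    have h1 : (D.hash i j).outer.colLen (r + 1) = 0 :=
      strip_outer_colLen_of_lt (D := D) h (r + 1)
    rw [h1] at hr
    exact absurd hr (Nat.not_lt_zero _)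
  · exact (D.isRightList_filter hS (D.exists_content_head i)
      (D.exists_content_tail j)).isFlags_strip hS h (D.exists_content_head i)
      (D.exists_content_tail j) hab

end OuterRibbonDecomposition

theorem mainTheorem5 {R : Type*} [CommRing R] (S : RShape) (hS : CellsConnected S.cells)
    (k : ℕ) (D : OuterRibbonDecomposition S k) (n : ℕ) (hn : S.width ≤ n)
    (a b : ℕ → ℤ) (hab : S.IsStrictFlags a b) (y z : ℤ → R) :
    (∀ i j : Fin k, (D.hash i j).IsFlags (D.inducedLower a i j) (D.inducedUpper b i j)) ∧
    S.flaggedSchur n a b y z =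
      Matrix.det (Matrix.of fun i j : Fin k => D.ribbonEntry a b y z i j) := by
  refine ⟨D.isFlags_hash hS hab, ?_⟩
  -- The cell matrix without pivots belongs to the columns, the one pivoted on `rightContents` to
  -- the ribbons, and their determinants agree.
  rw [S.flaggedSchur_eq_det_cellMatrix hn, ← RShape.det_cellMatrix hS
    (S.columnEntry_self a b y z) (S.columnEntry_of_lt a b y z)
    (D.pairwise_rightContents.imp fun h => ne_of_lt h)
    (fun c hc => (D.mem_rightContents.mp hc).1), D.det_cellMatrix_rightContents]
  simp only [D.ribbonEntry_eq_pivots hS]
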